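/- Let $k$ be an algebraically closed field, let $n\ge 2$, and let $\Gamma\subset\mathbb P^n_k$ be a set of $n+2$ distinct points in hyperplane linear position, that is: $n+1$ of the points span a hyperplane $H\subset\mathbb P^n$ and are in general linear position as points of $H\simeq\mathbb P^{n-1}$ (no $n$ of them are contained in a hyperplane of $H$), and the remaining point lies outside $H$. Let $J\subset R=k[x_0,\dots,x_n]$ be the ideal of $\Gamma$ (the intersection of the homogeneous prime ideals of the points of $\Gamma$), let $\Theta$ be the Jacobian matrix of any finite set of generators of $J$, let $I_n(\Theta)$ be the ideal generated by the $n\times n$ minors of $\Theta$, and put $I=(J,I_n(\Theta))$. Then the pair $J\subset I$ is Aluffi torsion-free, i.e. its Valabrega–Valla module vanishes: $$\bigoplus_{t\ge 2}\frac{J\cap I^t}{J\,I^{t-1}}=0 .$$ -/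

import Mathlib

open scoped DirectSum LinearAlgebra.Projectivization

/-- The points of `S` lie in the linear subvariety `ℙ(W)` of `ℙ(V)` and are in general linear
position as points of `ℙ(W)`, which is a projective space of dimension `N = dim W - 1`: either
there are at most `N` of them and they span a linear subspace of dimension `#S - 1`, or there are
at least `N + 1` of them and no `N + 1` of them are contained in a hyperplane of `ℙ(W)`. -/
def InGeneralLinearPosition {k V : Type*} [Field k] [AddCommGroup V] [Module k V]
    (W : Submodule k V) (S : Finset (ℙ k V)) : Prop :=
  (∀ p ∈ S, p.submodule ≤ W) ∧
  ((S.card < Module.finrank k W ∧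
      Module.finrank k (⨆ p ∈ S, p.submodule : Submodule k V) = S.card) ∨
    (Module.finrank k W ≤ S.card ∧
      ∀ T ⊆ S, T.card = Module.finrank k W →
        ∀ L ≤ W, Module.finrank k L + 1 = Module.finrank k W →
          ¬ ∀ p ∈ T, p.submodule ≤ L))

/-- A finite set `Γ` of at least `n + 2` points of `ℙⁿ` is in hyperplane linear position if it
consists of a set `Δ` of points that span a hyperplane `ℙ(H)` and are in general linear position
as points of `ℙ(H)`, and of one further point `q` that does not lie on that hyperplane. -/
def InHyperplaneLinearPosition {k : Type*} [Field k] {n : ℕ}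
    (Γ : Finset (ℙ k (Fin (n + 1) → k))) : Prop :=
  n + 2 ≤ Γ.card ∧
  ∃ (Δ : Finset (ℙ k (Fin (n + 1) → k))) (q : ℙ k (Fin (n + 1) → k)) (hq : q ∉ Δ)
    (H : Submodule k (Fin (n + 1) → k)),
    Γ = Finset.cons q Δ hq ∧
    Module.finrank k H = n ∧
    (⨆ p ∈ Δ, p.submodule) = H ∧
    InGeneralLinearPosition H Δ ∧
    ¬ q.submodule ≤ H

/-- The homogeneous prime ideal of a point `p` of `ℙⁿ`: the ideal of `k[x₀, …, xₙ]` generated by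
the forms that vanish at `p`. -/
noncomputable def idealOfPoint {k : Type*} [Field k] {n : ℕ} (p : ℙ k (Fin (n + 1) → k)) :
    Ideal (MvPolynomial (Fin (n + 1)) k) :=
  Ideal.span {F | (∃ d : ℕ, F.IsHomogeneous d) ∧ MvPolynomial.eval p.rep F = 0}

/-- The ideal of a finite set of points of `ℙⁿ`. -/
noncomputable def idealOfPoints {k : Type*} [Field k] {n : ℕ}
    (Γ : Finset (ℙ k (Fin (n + 1) → k))) : Ideal (MvPolynomial (Fin (n + 1)) k) :=
  ⨅ p ∈ Γ, idealOfPoint p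

/-- The Jacobian matrix of a family of polynomials. -/
noncomputable def jacobianMatrix {k ι σ : Type*} [CommRing k] (f : ι → MvPolynomial σ k) :
    Matrix ι σ (MvPolynomial σ k) :=
  Matrix.of fun i j => MvPolynomial.pderiv j (f i)

/-- The ideal `I_r(M)` generated by the `r × r` minors of a matrix `M`. -/
def minorsIdeal {R ι κ : Type*} [CommRing R] (r : ℕ) (M : Matrix ι κ R) : Ideal R :=
  Ideal.span {d | ∃ (a : Fin r ↪ ι) (b : Fin r ↪ κ), d = (M.submatrix a b).det}

/-- The Valabrega–Valla module `⨁_{t ≥ 2} (J ∩ I ^ t) / (J I ^ (t - 1))`. -/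
abbrev ValabregaVallaModule {R : Type*} [CommRing R] (J I : Ideal R) : Type _ :=
  ⨁ t : {t : ℕ // 2 ≤ t},
    (↥(J ⊓ I ^ t.1) ⧸ Submodule.submoduleOf (J * I ^ (t.1 - 1)) (J ⊓ I ^ t.1))

/-- The pair of ideals `J ⊆ I` is (Aluffi) torsion-free: its Valabrega–Valla module is zero. -/
def IsAluffiTorsionFree {R : Type*} [CommRing R] (J I : Ideal R) : Prop :=
  J ≤ I ∧ Subsingleton (ValabregaVallaModule J I)

/-! In suitable coordinates `Γ` consists of the coordinate points and of (0 : 1 : ⋯ : 1). To make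
this change of coordinates harmless, the ideal `I` is replaced by `jacobianIdeal`, which uses all
derivations and all elements of `J`; it is therefore independent of the generators and compatible
with automorphisms.

Write T = (x₁, …, xₙ) and r = max(n, 3). The computation rests on the equality I = J + (x₀ⁿ) + Tʳ
(`IsStandardIdeal.jacobianIdeal_eq`). For ⊆, J is generated by quadrics if n ≥ 3, and by two
quadrics and cubics if n = 2, so degrees force the minors into the right side. For ⊇, explicit
determinants in I of degree r separate the points on x₀ = 0, and interpolation gives all of Tʳ.

Since x₀T ⊆ J, cross terms in powers of I are absorbed: Iᵗ⁺¹ ⊆ J Iᵗ + (x₀^{n(t+1)}) + T^{r(t+1)}.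
Let F ∈ J lie in the last two summands. Vanishing at the coordinate points removes pure powers from
F. A monomial divisible by some x₀xᵢ is visibly in J Iᵗ. A mixed monomial in x₁, …, xₙ of degree d
is congruent to xᵤᵈ⁻¹xᵥ modulo J Tᵈ⁻³ ⊆ J Iᵗ, because r ≥ 3; vanishing at (0 : 1 : ⋯ : 1) makes
these normal forms cancel (`mem_of_forall_isMixed`, `inf_standardJacobianIdeal_pow_le`). -/

/-! ### The Jacobian ideal without generators or coordinates. -/

theorem MultilinearMap.map_mem_of_mem_span {R ι M N : Type*} [CommRing R] [Fintype ι]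
    [AddCommGroup M] [Module R M] [AddCommGroup N] [Module R N]
    (φ : MultilinearMap R (fun _ : ι => M) N) (Z : Set M) (P : Submodule R N)
    (h : ∀ v : ι → M, (∀ i, v i ∈ Z) → φ v ∈ P) (v : ι → M)
    (hv : ∀ i, v i ∈ Submodule.span R Z) : φ v ∈ P := by
  classical
  -- The set `s` collects the arguments already relaxed from `Z` to its span; it grows one argument
  -- at a time.
  suffices H : ∀ s : Finset ι, ∀ v : ι → M, (∀ i ∈ s, v i ∈ Submodule.span R Z) →
      (∀ i ∉ s, v i ∈ Z) → φ v ∈ P from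
    H Finset.univ v (fun i _ => hv i) (fun i hi => absurd (Finset.mem_univ i) hi)
  intro s
  induction s using Finset.induction_on with
  | empty => exact fun v _ hv => h v fun i => hv i (Finset.notMem_empty i)
  | insert i s hi ih =>
    intro v hs hn
    have key : ∀ x ∈ Submodule.span R Z, φ (Function.update v i x) ∈ P := by
      intro x hx
      induction hx using Submodule.span_induction with
      | mem x hx =>
        refine ih _ (fun j hj => ?_) (fun j hj => ?_)
        · rw [Function.update_of_ne (by rintro rfl; exact hi hj)]
          exact hs j (Finset.mem_insert_of_mem hj)
        · by_cases e : j = i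
          · subst e; simpa using hx
          · rw [Function.update_of_ne e]
            exact hn j (by simp [e, hj])
      | zero => simp
      | add x y _ _ hx hy => rw [φ.map_update_add]; exact P.add_mem hx hy
      | smul r x _ hx => rw [φ.map_update_smul]; exact P.smul_mem r hx
    simpa using key (v i) (hs i (Finset.mem_insert_self i s))

theorem Matrix.det_mem_of_row_mem {R ι : Type*} [CommRing R] [Fintype ι] [DecidableEq ι]
    (I : Ideal R) (M : Matrix ι ι R) (i : ι) (h : ∀ j, M i j ∈ I) : M.det ∈ I := by
  rw [← Ideal.Quotient.eq_zero_iff_mem, RingHom.map_det]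
  exact Matrix.det_eq_zero_of_row_eq_zero i fun j => by
    simpa [Ideal.Quotient.eq_zero_iff_mem] using h j

namespace MvPolynomial

variable {k σ : Type*} [CommRing k]

theorem derivation_apply_eq_sum [Fintype σ] (D : Derivation k (MvPolynomial σ k) (MvPolynomial σ k))
    (F : MvPolynomial σ k) : D F = ∑ j, D (X j) * pderiv j F := by
  classical
  have sum_apply : ∀ F, (∑ j, D (X j) • pderiv (R := k) j) F = ∑ j, (D (X j) • pderiv j F) :=
    fun F => by
      rw [← Derivation.coeFnAddMonoidHom_apply, map_sum, Finset.sum_apply]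
      rfl
  have h : D = ∑ j, D (X j) • pderiv j := derivation_ext fun i => by
    rw [sum_apply]
    simp [pderiv_X, Pi.single_apply]
  conv_lhs => rw [h]
  simp [sum_apply]

/-- Membership of all determinants `det (D_c F_a)`, for derivations `D_c` and elements `F_a` of the
ideal generated by `G`, in an ideal containing `G` can be tested on partial derivatives and on
elements of `G`. -/
theorem det_derivation_mem [Finite σ] {n : ℕ} (G : Set (MvPolynomial σ k))
    (I : Ideal (MvPolynomial σ k)) (hG : Ideal.span G ≤ I)
    (h : ∀ F : Fin n → MvPolynomial σ k, (∀ a, F a ∈ G) → ∀ b : Fin n → σ,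
      (Matrix.of fun a c => pderiv (b c) (F a)).det ∈ I)
    (F : Fin n → MvPolynomial σ k) (hF : ∀ a, F a ∈ Ideal.span G)
    (D : Fin n → Derivation k (MvPolynomial σ k) (MvPolynomial σ k)) :
    (Matrix.of fun a c => D c (F a)).det ∈ I := by
  classical
  have := Fintype.ofFinite σ
  -- Multilinearity in the columns: each derivation is a polynomial combination of partial
  -- derivatives.
  have h1 : ∀ F : Fin n → MvPolynomial σ k, (∀ a, F a ∈ G) →
      (Matrix.of fun a c => D c (F a)).det ∈ I := by
    intro F hF
    rw [← Matrix.det_transpose]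
    refine (Matrix.detRowAlternating (n := Fin n)
      (R := MvPolynomial σ k)).toMultilinearMap.map_mem_of_mem_span
      {w | ∃ j : σ, w = fun a => pderiv j (F a)} I ?_ _ ?_
    · intro v hv
      choose b hb using hv
      have := h F hF b
      rw [← Matrix.det_transpose] at this
      convert this using 1
      change Matrix.det v = _
      congr 1
      ext i j
      simp [hb]
    · intro c
      have : (fun a => D c (F a)) = ∑ j, D c (X j) • (fun a => pderiv j (F a)) := by
        ext1 a
        rw [derivation_apply_eq_sum]
        simp
      change (fun a => D c (F a)) ∈ _
      rw [this]
      exact Submodule.sum_mem _ fun j _ => Submodule.smul_mem _ _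
        (Submodule.subset_span ⟨j, rfl⟩)
  -- Multilinearity in the rows: by the Leibniz rule, `D (r x)` is `r D x` plus a row with entries
  -- in `Ideal.span G`, and such a row puts the determinant into `I`.
  refine (Matrix.detRowAlternating (n := Fin n)
    (R := MvPolynomial σ k)).toMultilinearMap.map_mem_of_mem_span
    ({w | ∃ g ∈ G, w = fun c => D c g} ∪ {w | ∀ c, w c ∈ Ideal.span G}) I ?_ _ ?_
  · intro v hv
    by_cases H : ∃ i, ∀ c, v i c ∈ Ideal.span G
    · obtain ⟨i, hi⟩ := H
      exact hG (Matrix.det_mem_of_row_mem _ v i hi)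
    · have : ∀ i, ∃ g ∈ G, v i = fun c => D c g := fun i =>
        (hv i).resolve_right fun hi => H ⟨i, hi⟩
      choose g hg hgv using this
      convert h1 g hg using 1
      change Matrix.det v = _
      congr 1
      ext i j
      simp [hgv]
  · intro a
    change (fun c => D c (F a)) ∈ _
    generalize F a = x, hF a = hx
    induction hx using Submodule.span_induction with
    | mem x hx => exact Submodule.subset_span (Or.inl ⟨x, hx, rfl⟩)
    | zero =>
      simp only [map_zero]
      exact Submodule.zero_mem _
    | add x y _ _ hx hy =>
      simp only [map_add]
      exact Submodule.add_mem _ hx hy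
    | smul r x hx' hx =>
      have : (fun c => D c (r • x)) = r • (fun c => D c x) + fun c => x * D c r := by
        ext1 c
        simp
      rw [this]
      exact Submodule.add_mem _ (Submodule.smul_mem _ _ hx)
        (Submodule.subset_span (Or.inr fun c => Ideal.mul_mem_right _ _ hx'))

/-- The ideal generated by an ideal `J` and all determinants `det (D_b F_a)` of size `n`, for
derivations `D_b` and elements `F_a` of `J`. -/
noncomputable def jacobianIdeal (n : ℕ) (J : Ideal (MvPolynomial σ k)) :
    Ideal (MvPolynomial σ k) :=
  J ⊔ Ideal.span {d | ∃ (F : Fin n → MvPolynomial σ k)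
    (D : Fin n → Derivation k (MvPolynomial σ k) (MvPolynomial σ k)),
    (∀ a, F a ∈ J) ∧ d = (Matrix.of fun a c => D c (F a)).det}

theorem le_jacobianIdeal (n : ℕ) (J : Ideal (MvPolynomial σ k)) : J ≤ jacobianIdeal n J :=
  le_sup_left

theorem det_mem_jacobianIdeal {n : ℕ} {J : Ideal (MvPolynomial σ k)}
    {F : Fin n → MvPolynomial σ k} (hF : ∀ a, F a ∈ J)
    (D : Fin n → Derivation k (MvPolynomial σ k) (MvPolynomial σ k)) :
    (Matrix.of fun a c => D c (F a)).det ∈ jacobianIdeal n J :=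
  Ideal.mem_sup_right (Ideal.subset_span ⟨F, D, hF, rfl⟩)

theorem jacobianIdeal_le {n : ℕ} (G : Set (MvPolynomial σ k)) [Finite σ]
    (I : Ideal (MvPolynomial σ k)) (hG : Ideal.span G ≤ I)
    (h : ∀ F : Fin n → MvPolynomial σ k, (∀ a, F a ∈ G) → ∀ b : Fin n → σ,
      (Matrix.of fun a c => pderiv (b c) (F a)).det ∈ I) :
    jacobianIdeal n (Ideal.span G) ≤ I := by
  refine sup_le hG (Ideal.span_le.2 ?_)
  rintro _ ⟨F, D, hF, rfl⟩
  exact det_derivation_mem G I hG h F hF D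

/-- This frees the ideal of the theorem from the choice of generators. Minors use injective index
maps; a repeated row or column contributes a zero determinant. -/
theorem sup_minorsIdeal_eq_jacobianIdeal [Finite σ] {ι : Type*} (n : ℕ)
    (f : ι → MvPolynomial σ k) :
    Ideal.span (Set.range f) ⊔ minorsIdeal n (jacobianMatrix f) =
      jacobianIdeal n (Ideal.span (Set.range f)) := by
  classical
  apply le_antisymm
  · refine sup_le (le_jacobianIdeal _ _) (Ideal.span_le.2 ?_)
    rintro _ ⟨a, b, rfl⟩
    exact det_mem_jacobianIdeal (F := fun i => f (a i))
      (fun i => Ideal.subset_span (Set.mem_range_self (a i))) (fun c => pderiv (b c))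
  · refine jacobianIdeal_le _ _ le_sup_left ?_
    intro F hF b
    choose a ha using fun i => Set.mem_range.1 (hF i)
    by_cases hb : Function.Injective b
    · by_cases haj : Function.Injective a
      · refine Ideal.mem_sup_right ?_
        unfold minorsIdeal
        refine Ideal.subset_span ⟨⟨a, haj⟩, ⟨b, hb⟩, ?_⟩
        congr 1
        ext1 i j
        simp [jacobianMatrix, ha]
      · obtain ⟨i, j, hij, hne⟩ := Function.not_injective_iff.1 haj
        rw [Matrix.det_zero_of_row_eq hne]
        · exact Ideal.zero_mem _
        · ext1 c
          simp [← ha, hij]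
    · obtain ⟨i, j, hij, hne⟩ := Function.not_injective_iff.1 hb
      rw [Matrix.det_zero_of_column_eq hne]
      · exact Ideal.zero_mem _
      · intro c
        simp [hij]

/-- Conjugating a derivation by `e` gives a derivation, so `e` carries the defining determinants to
determinants of the same kind. -/
theorem map_jacobianIdeal_le (n : ℕ) (J : Ideal (MvPolynomial σ k))
    (e : MvPolynomial σ k ≃ₐ[k] MvPolynomial σ k) :
    (jacobianIdeal n J).map e ≤ jacobianIdeal n (J.map e) := by
  rw [jacobianIdeal, Ideal.map_sup, Ideal.map_span]
  refine sup_le (le_jacobianIdeal _ _) (Ideal.span_le.2 ?_)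
  rintro _ ⟨_, ⟨F, D, hF, rfl⟩, rfl⟩
  let D' : Fin n → Derivation k (MvPolynomial σ k) (MvPolynomial σ k) := fun c =>
    Derivation.mk' (e.toLinearMap ∘ₗ (D c).toLinearMap ∘ₗ e.symm.toLinearMap) (by
      intro a b; simp)
  have := det_mem_jacobianIdeal (J := J.map e) (F := fun a => e (F a))
    (fun a => Ideal.mem_map_of_mem e (hF a)) D'
  refine Eq.subst (motive := fun x => x ∈ jacobianIdeal n (J.map e)) ?_ this
  symm
  rw [AlgEquiv.map_det]
  congr 1
  ext1 i j
  simp only [D', Matrix.of_apply, AlgEquiv.mapMatrix_apply, Matrix.map_apply]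
  change e (D j (F i)) = e (D j (e.symm (e (F i))))
  rw [e.symm_apply_apply]

theorem map_jacobianIdeal (n : ℕ) (J : Ideal (MvPolynomial σ k))
    (e : MvPolynomial σ k ≃ₐ[k] MvPolynomial σ k) :
    (jacobianIdeal n J).map e = jacobianIdeal n (J.map e) := by
  refine le_antisymm (map_jacobianIdeal_le n J e) ?_
  have h := Ideal.map_mono (f := e) (map_jacobianIdeal_le n (J.map e) e.symm)
  have h1 : ∀ K : Ideal (MvPolynomial σ k), (K.map e.symm).map e = K := fun K =>
    Ideal.map_of_equiv (I := K) e.symm.toRingEquiv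
  have h2 : (J.map e).map e.symm = J := Ideal.map_of_equiv (I := J) e.toRingEquiv
  rwa [h1, h2] at h

end MvPolynomial

/-! ### Torsion-freeness as inclusions of ideals, and their transport along isomorphisms. -/

theorem isAluffiTorsionFree_of_le {R : Type*} [CommRing R] {J I : Ideal R} (hJI : J ≤ I)
    (h : ∀ t, 2 ≤ t → J ⊓ I ^ t ≤ J * I ^ (t - 1)) : IsAluffiTorsionFree J I := by
  refine ⟨hJI, ?_⟩
  have : ∀ t : {t : ℕ // 2 ≤ t}, Subsingleton
      (↥(J ⊓ I ^ t.1) ⧸ Submodule.submoduleOf (J * I ^ (t.1 - 1)) (J ⊓ I ^ t.1)) := by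
    intro t
    rw [Submodule.Quotient.subsingleton_iff, Submodule.submoduleOf_eq_top]
    exact h t.1 t.2
  infer_instance

theorem Ideal.inf_pow_le_of_map_equiv {R S : Type*} [CommRing R] [CommRing S] (e : R ≃+* S)
    {J I : Ideal R} {t : ℕ}
    (h : J.map e ⊓ I.map e ^ t ≤ J.map e * I.map e ^ (t - 1)) :
    J ⊓ I ^ t ≤ J * I ^ (t - 1) := by
  rintro x ⟨hx, hx'⟩
  have h1 : e x ∈ J.map e * I.map e ^ (t - 1) := h ⟨Ideal.mem_map_of_mem e hx, by
    rw [← Ideal.map_pow]; exact Ideal.mem_map_of_mem e hx'⟩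
  rw [← Ideal.map_pow, ← Ideal.map_mul] at h1
  simpa [Ideal.mem_map_of_equiv] using h1

/-! ### Standard ideals and normal forms of monomials. -/

namespace MvPolynomial

variable {k : Type*} [Field k] {n : ℕ}

/-- `J` is the ideal of the coordinate points and of `(0 : 1 : ⋯ : 1)` in `ℙⁿ`. -/
def IsStandardIdeal (J : Ideal (MvPolynomial (Fin (n + 1)) k)) : Prop :=
  ∀ F, F ∈ J ↔ ∀ d, (∀ i, eval (Pi.single i 1) (homogeneousComponent d F) = 0) ∧
    eval (Fin.cons 0 1 : Fin (n + 1) → k) (homogeneousComponent d F) = 0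

/-- The ideal of the first coordinate point. -/
noncomputable def tailIdeal (k : Type*) [Field k] (n : ℕ) : Ideal (MvPolynomial (Fin (n + 1)) k) :=
  Ideal.span (Set.range fun i : Fin n => X i.succ)

/-- The degree of a monomial in the variables other than the first. -/
def tailDegree (s : Fin (n + 1) →₀ ℕ) : ℕ := ∑ i : Fin n, s i.succ

theorem degree_eq_add_tailDegree (s : Fin (n + 1) →₀ ℕ) : s.degree = s 0 + tailDegree s := by
  rw [Finsupp.degree_eq_sum, Fin.sum_univ_succ, tailDegree]

theorem tailDegree_add (s t : Fin (n + 1) →₀ ℕ) :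
    tailDegree (s + t) = tailDegree s + tailDegree t := by
  simp [tailDegree, Finset.sum_add_distrib]

theorem tailDegree_mono {s t : Fin (n + 1) →₀ ℕ} (h : s ≤ t) : tailDegree s ≤ tailDegree t :=
  Finset.sum_le_sum fun i _ => h i.succ

@[simp] theorem tailDegree_single_succ (i : Fin n) (m : ℕ) :
    tailDegree (Finsupp.single i.succ m) = m := by
  simp [tailDegree, Finsupp.single_apply]

theorem X_succ_mem_tailIdeal (i : Fin n) : (X i.succ : MvPolynomial _ k) ∈ tailIdeal k n :=
  Ideal.subset_span ⟨i, rfl⟩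

theorem monomial_mem_tailIdeal_pow {s : Fin (n + 1) →₀ ℕ} {q : ℕ} (h : q ≤ tailDegree s) (c : k) :
    monomial s c ∈ tailIdeal k n ^ q := by
  refine Ideal.pow_le_pow_right h ?_
  rw [monomial_eq, Finsupp.prod_fintype _ _ (by simp), Fin.prod_univ_succ, tailDegree,
    ← Finset.prod_pow_eq_pow_sum]
  exact Ideal.mul_mem_left _ _ (Ideal.mul_mem_left _ _
    (Ideal.prod_mem_prod fun i _ => Ideal.pow_mem_pow (X_succ_mem_tailIdeal i) _))

theorem mem_tailIdeal_pow_iff {q : ℕ} {F : MvPolynomial (Fin (n + 1)) k} :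
    F ∈ tailIdeal k n ^ q ↔ ∀ s ∈ F.support, q ≤ tailDegree s := by
  constructor
  -- `W q` is a monomial ideal, so membership can be read off the support.
  · let W : ℕ → Ideal (MvPolynomial (Fin (n + 1)) k) := fun q =>
      Ideal.span ((fun s => monomial s (1 : k)) '' {s | q ≤ tailDegree s})
    have hW : tailIdeal k n ^ q ≤ W q := by
      induction q with
      | zero =>
        rw [pow_zero, Ideal.one_eq_top, top_le_iff, Ideal.eq_top_iff_one]
        exact Ideal.subset_span ⟨0, by simp, rfl⟩
      | succ q ih =>
        have h1 : tailIdeal k n ≤ W 1 := by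
          refine Ideal.span_le.2 ?_
          rintro _ ⟨i, rfl⟩
          exact Ideal.subset_span ⟨Finsupp.single i.succ 1, by simp, rfl⟩
        rw [pow_succ]
        refine (Ideal.mul_mono ih h1).trans ?_
        rw [Ideal.span_mul_span', Ideal.span_le]
        rintro _ ⟨_, ⟨s, hs, rfl⟩, _, ⟨t, ht, rfl⟩, rfl⟩
        refine Ideal.subset_span ⟨s + t, ?_, by simp [monomial_mul]⟩
        simp only [Set.mem_ofPred_eq, tailDegree_add] at *
        omega
    intro hF s hs
    obtain ⟨t, ht, hts⟩ := mem_ideal_span_monomial_image.1 (hW hF) s hs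
    exact le_trans ht (tailDegree_mono hts)
  · intro h
    rw [F.as_sum]
    exact Ideal.sum_mem _ fun s hs => monomial_mem_tailIdeal_pow (h s hs) _

/-- A monomial that involves at least two of the variables. -/
def IsMixed (s : Fin (n + 1) →₀ ℕ) : Prop := ∃ a b, a ≠ b ∧ s a ≠ 0 ∧ s b ≠ 0

theorem exists_eq_single_of_not_isMixed {s : Fin (n + 1) →₀ ℕ} (h : ¬ IsMixed s) :
    ∃ i, s = Finsupp.single i s.degree := by
  by_cases hs : s = 0
  · exact ⟨0, by simp [hs]⟩
  · obtain ⟨i, hi⟩ := Finsupp.ne_iff.1 hs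
    have h1 : ∀ j, j ≠ i → s j = 0 := fun j hj => by
      by_contra h2
      exact h ⟨j, i, hj, h2, hi⟩
    have h2 : s = Finsupp.single i (s i) := by
      ext j
      by_cases hj : j = i
      · simp [hj]
      · rw [h1 j hj, Finsupp.single_eq_of_ne hj]
    refine ⟨i, ?_⟩
    rw [h2]
    simp

/-- The normal form modulo a standard ideal of the monomial with a mixed exponent `s`. -/
noncomputable def mixedNormalForm (k : Type*) [Field k] (u v : Fin n) (s : Fin (n + 1) →₀ ℕ) :
    MvPolynomial (Fin (n + 1)) k :=
  C ((0 : k) ^ s 0) * (X u.succ ^ (s.degree - 1) * X v.succ)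

/-- Vanishing of a form at a coordinate point thus means the absence of a pure power. -/
theorem eval_single_of_isHomogeneous {F : MvPolynomial (Fin (n + 1)) k} {d : ℕ}
    (hF : F.IsHomogeneous d) (i : Fin (n + 1)) :
    eval (Pi.single i 1) F = coeff (Finsupp.single i d) F := by
  rw [eval_eq']
  rw [Finset.sum_eq_single (Finsupp.single i d)]
  · rw [Finset.prod_eq_one, mul_one]
    intro j _
    by_cases hj : j = i
    · subst hj; simp
    · simp [Finsupp.single_eq_of_ne hj]
  · intro s hs hne
    have : ∃ j, j ≠ i ∧ s j ≠ 0 := by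
      by_contra! h
      apply hne
      have hd := hF (mem_support_iff.1 hs)
      have h2 : s = Finsupp.single i (s i) := by
        ext j
        by_cases hj : j = i
        · simp [hj]
        · rw [h j hj, Finsupp.single_eq_of_ne hj]
      rw [h2] at hd ⊢
      simp [Finsupp.weight_single] at hd
      rw [hd]
    obtain ⟨j, hj, hj'⟩ := this
    rw [Finset.prod_eq_zero (Finset.mem_univ j), mul_zero]
    rw [Pi.single_eq_of_ne hj, zero_pow hj']
  · intro h
    rw [notMem_support_iff.1 h, zero_mul]

/-- With `0 ^ 0 = 1`, this is the scalar factor in `mixedNormalForm`, so normal forms weigh each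
monomial by its value at (0 : 1 : ⋯ : 1). -/
theorem prod_cons_zero_one (s : Fin (n + 1) →₀ ℕ) :
    ∏ i, (Fin.cons 0 1 : Fin (n + 1) → k) i ^ s i = 0 ^ s 0 := by
  simp [Fin.prod_univ_succ]

namespace IsStandardIdeal

variable {J : Ideal (MvPolynomial (Fin (n + 1)) k)} (hJ : IsStandardIdeal J)
include hJ

theorem mem_iff_of_isHomogeneous {F : MvPolynomial (Fin (n + 1)) k} {d : ℕ}
    (hF : F.IsHomogeneous d) :
    F ∈ J ↔ (∀ i, eval (Pi.single i 1) F = 0) ∧ eval (Fin.cons 0 1 : Fin (n + 1) → k) F = 0 := by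
  rw [hJ]
  constructor
  · intro h
    have := h d
    rwa [homogeneousComponent_eq_self hF] at this
  · intro h e
    rw [homogeneousComponent_of_mem hF]
    split_ifs
    · exact h
    · simp

theorem homogeneousComponent_mem {F : MvPolynomial (Fin (n + 1)) k} (hF : F ∈ J) (d : ℕ) :
    homogeneousComponent d F ∈ J :=
  (hJ.mem_iff_of_isHomogeneous (homogeneousComponent_isHomogeneous d F)).2 ((hJ F).1 hF d)

/-- A component of `F` has no pure powers, by vanishing at the coordinate points. Its normal forms
add up to its value at (0 : 1 : ⋯ : 1) times one fixed monomial, which is zero; hence it is a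
combination of the differences assumed to lie in `K`. -/
theorem mem_of_forall_isMixed {F : MvPolynomial (Fin (n + 1)) k} (hF : F ∈ J)
    (K : Ideal (MvPolynomial (Fin (n + 1)) k)) (u v : Fin n)
    (h : ∀ s ∈ F.support, IsMixed s → monomial s 1 - mixedNormalForm k u v s ∈ K) : F ∈ K := by
  classical
  suffices H : ∀ d, homogeneousComponent d F ∈ K by
    rw [← sum_homogeneousComponent F]
    exact Ideal.sum_mem _ fun d _ => H d
  intro d
  set G := homogeneousComponent d F with hG
  have hGh : G.IsHomogeneous d := homogeneousComponent_isHomogeneous d F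
  have hGs : ∀ s ∈ G.support, s ∈ F.support := by
    intro s hs
    rw [mem_support_iff, coeff_homogeneousComponent] at hs
    split_ifs at hs
    · exact mem_support_iff.2 hs
    · exact absurd rfl hs
  obtain ⟨h1, h2⟩ := (hJ.mem_iff_of_isHomogeneous hGh).1 (hJ.homogeneousComponent_mem hF d)
  have hdeg : ∀ s ∈ G.support, s.degree = d := fun s hs => (hGh.degree_eq_sum_deg_support hs).symm
  have hmix : ∀ s ∈ G.support, IsMixed s := by
    intro s hs
    by_contra hm
    obtain ⟨i, hi⟩ := exists_eq_single_of_not_isMixed hm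
    rw [hdeg s hs] at hi
    have := h1 i
    rw [eval_single_of_isHomogeneous hGh, ← hi] at this
    exact mem_support_iff.1 hs this
  have hsum : G = ∑ s ∈ G.support, C (coeff s G) * (monomial s 1 - mixedNormalForm k u v s) := by
    have e2 : ∑ s ∈ G.support, C (coeff s G) * mixedNormalForm k u v s = 0 := by
      rw [eval_eq'] at h2
      calc _ = ∑ s ∈ G.support, C (coeff s G * ∏ i, (Fin.cons 0 1 : Fin (n + 1) → k) i ^ s i) *
            (X u.succ ^ (d - 1) * X v.succ) := by
            refine Finset.sum_congr rfl fun s hs => ?_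
            rw [mixedNormalForm, hdeg s hs, prod_cons_zero_one, C_mul, mul_assoc]
        _ = 0 := by
            rw [← Finset.sum_mul, ← map_sum, h2, C_0, zero_mul]
    simp_rw [mul_sub]
    rw [Finset.sum_sub_distrib, e2, sub_zero]
    conv_lhs => rw [G.as_sum]
    simp [C_mul_monomial]
  rw [hsum]
  exact Ideal.sum_mem _ fun s hs => Ideal.mul_mem_left _ _ (h s (hGs s hs) (hmix s hs))

theorem X_zero_mul_X_mem (i : Fin n) : X 0 * X i.succ ∈ J := by
  rw [hJ.mem_iff_of_isHomogeneous ((isHomogeneous_X k 0).mul (isHomogeneous_X k i.succ))]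
  refine ⟨fun j => ?_, by simp⟩
  by_cases h : j = 0
  · subst h; simp
  · simp [Pi.single_apply, Ne.symm h]

theorem cubic_mem {a b u v : Fin n} (hab : a ≠ b) (huv : u ≠ v) (c : Fin n) :
    X a.succ * X b.succ * X c.succ - X u.succ * X u.succ * X v.succ ∈ J := by
  have hX := fun i : Fin n => isHomogeneous_X k i.succ
  rw [hJ.mem_iff_of_isHomogeneous ((((hX a).mul (hX b)).mul (hX c)).sub
    (((hX u).mul (hX u)).mul (hX v)))]
  refine ⟨fun j => ?_, by simp⟩
  simp only [Pi.single_apply, map_sub, map_mul, eval_X]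
  have h1 : ¬ (a.succ = j ∧ b.succ = j) := fun h => hab (Fin.succ_injective _ (h.1.trans h.2.symm))
  have h2 : ¬ (u.succ = j ∧ v.succ = j) := fun h => huv (Fin.succ_injective _ (h.1.trans h.2.symm))
  split_ifs <;> simp_all

theorem X_zero_mul_mem {F : MvPolynomial (Fin (n + 1)) k} (hF : F ∈ tailIdeal k n) :
    X 0 * F ∈ J := by
  induction hF using Submodule.span_induction with
  | mem x hx => obtain ⟨i, rfl⟩ := hx; exact hJ.X_zero_mul_X_mem i
  | zero => simp
  | add x y _ _ hx hy => rw [mul_add]; exact J.add_mem hx hy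
  | smul r x _ hx => rw [smul_eq_mul, mul_left_comm]; exact J.mul_mem_left r hx

end IsStandardIdeal

theorem exists_eq_single_succ_add {w : Fin (n + 1) →₀ ℕ} (h0 : w 0 = 0) (hw : w ≠ 0) :
    ∃ (c : Fin n) (w' : Fin (n + 1) →₀ ℕ), w = Finsupp.single c.succ 1 + w' ∧ w' 0 = 0 := by
  obtain ⟨i, hi⟩ := Finsupp.ne_iff.1 hw
  have hi0 : i ≠ 0 := by rintro rfl; exact hi h0
  obtain ⟨c, rfl⟩ := Fin.exists_succ_eq.2 hi0
  refine ⟨c, w - Finsupp.single c.succ 1, ?_, by simp [h0]⟩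
  rw [add_tsub_cancel_of_le]
  rw [Finsupp.single_le_iff]
  exact Nat.one_le_iff_ne_zero.2 hi

/-- Each further variable is traded for `X u.succ` at the cost of one cubic relation, which leaves a
cofactor of degree `d`. The ideal `N` is arbitrary because the lemma serves both for `J` itself and
for proving that given elements generate `J`. -/
theorem mul_monomial_sub_mem (N : Ideal (MvPolynomial (Fin (n + 1)) k)) {u v a b : Fin n}
    (hN : ∀ a b c : Fin n, a ≠ b →
      X a.succ * X b.succ * X c.succ - X u.succ * X u.succ * X v.succ ∈ N)
    (hab : a ≠ b) (huv : u ≠ v) (d : ℕ) (w : Fin (n + 1) →₀ ℕ) (hw : w.degree = d + 1)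
    (h0 : w 0 = 0) :
    X a.succ * X b.succ * monomial w 1 - X u.succ ^ (d + 2) * X v.succ ∈ N * tailIdeal k n ^ d := by
  induction d generalizing w with
  | zero =>
    obtain ⟨c, w', rfl, h0'⟩ := exists_eq_single_succ_add h0 (by rintro rfl; simp at hw)
    have : w' = 0 := by
      rw [map_add, Finsupp.degree_single] at hw
      rw [← Finsupp.degree_eq_zero_iff]
      omega
    subst this
    have := hN a b c hab
    rw [pow_zero, mul_one, add_zero, zero_add, pow_two]
    exact this
  | succ d ih =>
    obtain ⟨c, w', rfl, h0'⟩ := exists_eq_single_succ_add h0 (by rintro rfl; simp at hw)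
    have hw' : w'.degree = d + 1 := by
      rw [map_add, Finsupp.degree_single] at hw
      omega
    have e : (X a.succ * X b.succ * monomial (Finsupp.single c.succ 1 + w') 1 -
        X u.succ ^ (d + 1 + 2) * X v.succ : MvPolynomial (Fin (n + 1)) k) =
        (X a.succ * X b.succ * monomial w' 1 - X u.succ ^ (d + 2) * X v.succ) * X c.succ +
        (X u.succ * X v.succ * X c.succ - X u.succ * X u.succ * X v.succ) *
          X u.succ ^ (d + 1) := by
      have : (monomial (Finsupp.single c.succ 1 + w') 1 : MvPolynomial (Fin (n + 1)) k) =
          X c.succ * monomial w' 1 := by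
        rw [X, monomial_mul, one_mul]
      rw [this]
      ring
    rw [e]
    refine Ideal.add_mem _ ?_ ?_
    · rw [pow_succ, ← mul_assoc]
      exact Ideal.mul_mem_mul (ih w' hw' h0') (X_succ_mem_tailIdeal c)
    · exact Ideal.mul_mem_mul (hN u v c huv) (Ideal.pow_mem_pow (X_succ_mem_tailIdeal u) _)

theorem IsMixed.exists_eq_add {s : Fin (n + 1) →₀ ℕ} (hs : IsMixed s) (h0 : s 0 = 0) :
    ∃ (a b : Fin n) (w : Fin (n + 1) →₀ ℕ), a ≠ b ∧ w 0 = 0 ∧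
      s = Finsupp.single a.succ 1 + Finsupp.single b.succ 1 + w := by
  obtain ⟨i, j, hij, hi, hj⟩ := hs
  have hi0 : i ≠ 0 := by rintro rfl; exact hi h0
  have hj0 : j ≠ 0 := by rintro rfl; exact hj h0
  obtain ⟨a, rfl⟩ := Fin.exists_succ_eq.2 hi0
  obtain ⟨b, rfl⟩ := Fin.exists_succ_eq.2 hj0
  refine ⟨a, b, s - (Finsupp.single a.succ 1 + Finsupp.single b.succ 1),
    fun h => hij (by rw [h]), by simp [h0], ?_⟩
  rw [add_tsub_cancel_of_le]
  intro l
  simp only [Finsupp.add_apply, Finsupp.single_apply]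
  split_ifs with h1 h2 h2
  · exact absurd (h1.trans h2.symm) hij
  · subst h1; omega
  · subst h2; omega
  · omega

theorem monomial_single_add_single_add (a b : Fin n) (w : Fin (n + 1) →₀ ℕ) :
    (monomial (Finsupp.single a.succ 1 + Finsupp.single b.succ 1 + w) 1 :
      MvPolynomial (Fin (n + 1)) k) = X a.succ * X b.succ * monomial w 1 := by
  simp [X, monomial_mul]

theorem monomial_sub_mixedNormalForm_mem (N : Ideal (MvPolynomial (Fin (n + 1)) k)) {u v : Fin n}
    (hN : ∀ a b c : Fin n, a ≠ b →
      X a.succ * X b.succ * X c.succ - X u.succ * X u.succ * X v.succ ∈ N)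
    (huv : u ≠ v) {s : Fin (n + 1) →₀ ℕ} (hs : IsMixed s) (h0 : s 0 = 0) {d : ℕ}
    (hd : s.degree = d + 3) :
    monomial s 1 - mixedNormalForm k u v s ∈ N * tailIdeal k n ^ d := by
  obtain ⟨a, b, w, hab, hw0, rfl⟩ := hs.exists_eq_add h0
  rw [mixedNormalForm, h0, hd, monomial_single_add_single_add, pow_zero, C_1, one_mul]
  exact mul_monomial_sub_mem N hN hab huv d w
    (by simp only [map_add, Finsupp.degree_single] at hd; omega) hw0

end MvPolynomial

/-! ### The explicit ideal J + (x₀ⁿ) + Tʳ, its powers and their intersections with J. -/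

namespace MvPolynomial

variable {k : Type*} [Field k] {n : ℕ}

theorem IsMixed.monomial_eq_of_ne_zero {s : Fin (n + 1) →₀ ℕ} (hs : IsMixed s) (h0 : s 0 ≠ 0) :
    ∃ (i : Fin n) (w : Fin (n + 1) →₀ ℕ), w 0 + 1 = s 0 ∧ tailDegree w + 1 = tailDegree s ∧
      (monomial s 1 : MvPolynomial (Fin (n + 1)) k) = X 0 * X i.succ * monomial w 1 := by
  have : ∃ j, j ≠ 0 ∧ s j ≠ 0 := by
    obtain ⟨a, b, hab, ha, hb⟩ := hs
    by_cases h : a = 0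
    · exact ⟨b, fun hb => hab (h.trans hb.symm), hb⟩
    · exact ⟨a, h, ha⟩
  obtain ⟨j, hj, hsj⟩ := this
  obtain ⟨i, rfl⟩ := Fin.exists_succ_eq.2 hj
  have e : Finsupp.single 0 1 + Finsupp.single i.succ 1 +
      (s - (Finsupp.single 0 1 + Finsupp.single i.succ 1)) = s := by
    rw [add_tsub_cancel_of_le]
    intro l
    simp only [Finsupp.add_apply, Finsupp.single_apply]
    split_ifs with h1 h2 h2
    · exact absurd (h1.trans h2.symm) hj.symm
    · subst h1; omega
    · subst h2; omega
    · omega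
  set w := s - (Finsupp.single 0 1 + Finsupp.single i.succ 1) with hw
  refine ⟨i, w, ?_, ?_, ?_⟩
  · rw [hw]; simp; omega
  · rw [← e, tailDegree_add, tailDegree_add, tailDegree_single_succ]
    simp [tailDegree]; omega
  · rw [← e]
    simp [X, monomial_mul]

theorem monomial_eq_X_zero_pow_mul {s : Fin (n + 1) →₀ ℕ} {a : ℕ} (h : a ≤ s 0) :
    ∃ G : MvPolynomial (Fin (n + 1)) k, monomial s 1 = X 0 ^ a * G := by
  refine ⟨monomial (s - Finsupp.single 0 a) 1, ?_⟩
  rw [X_pow_eq_monomial, monomial_mul, one_mul, add_tsub_cancel_of_le]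
  simpa using h

/-- The explicit description of the Jacobian ideal of a standard ideal `J`. -/
noncomputable def standardJacobianIdeal (J : Ideal (MvPolynomial (Fin (n + 1)) k)) (r : ℕ) :
    Ideal (MvPolynomial (Fin (n + 1)) k) :=
  J ⊔ (Ideal.span {X 0 ^ n} ⊔ tailIdeal k n ^ r)

section

variable {J : Ideal (MvPolynomial (Fin (n + 1)) k)} {r : ℕ}

theorem le_standardJacobianIdeal : J ≤ standardJacobianIdeal J r := le_sup_left

theorem X_zero_pow_mem_standardJacobianIdeal : X 0 ^ n ∈ standardJacobianIdeal J r :=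
  Ideal.mem_sup_right (Ideal.mem_sup_left (Ideal.mem_span_singleton_self _))

theorem tailIdeal_pow_le_standardJacobianIdeal :
    tailIdeal k n ^ r ≤ standardJacobianIdeal J r :=
  le_sup_right.trans le_sup_right

theorem X_zero_pow_mem_pow (t : ℕ) : X 0 ^ (n * t) ∈ standardJacobianIdeal J r ^ t := by
  rw [pow_mul]
  exact Ideal.pow_mem_pow X_zero_pow_mem_standardJacobianIdeal t

theorem tailIdeal_pow_le_pow (t : ℕ) :
    tailIdeal k n ^ (r * t) ≤ standardJacobianIdeal J r ^ t := by
  rw [pow_mul]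
  exact Ideal.pow_right_mono tailIdeal_pow_le_standardJacobianIdeal t

namespace IsStandardIdeal

variable (hJ : IsStandardIdeal J)
include hJ

/-- Only products of x₀-powers with elements of T-powers need care. One factor x₀y with y ∈ T is
split off into J; the cofactor still lies in the required power of I, since the leftover x₀ⁿ⁻¹Tʳ⁻¹
is contained in J ⊆ I. -/
theorem standardJacobianIdeal_pow_le (hn : 2 ≤ n) (hr : 2 ≤ r) (t : ℕ) :
    standardJacobianIdeal J r ^ (t + 1) ≤ J * standardJacobianIdeal J r ^ t ⊔
      (Ideal.span {X 0 ^ (n * (t + 1))} ⊔ tailIdeal k n ^ (r * (t + 1))) := by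
  induction t with
  | zero => simp [standardJacobianIdeal]
  | succ t ih =>
    set I := standardJacobianIdeal J r with hI
    have hX : ∀ G ∈ tailIdeal k n, X 0 * G ∈ J := fun G hG => hJ.X_zero_mul_mem hG
    -- a product of a pure power of the first variable and a power of the tail
    have mixed : ∀ (a b : ℕ), ∀ G ∈ tailIdeal k n ^ (b + 1), ∀ c : ℕ,
        (∀ H ∈ tailIdeal k n ^ b, X 0 ^ a * H ∈ I ^ c) →
        X 0 ^ (a + 1) * G ∈ J * I ^ c := by
      intro a b G hG c h
      rw [pow_succ] at hG
      induction hG using Submodule.mul_induction_on' with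
      | mem_mul_mem x hx y hy =>
        have : X 0 ^ (a + 1) * (x * y) = (X 0 * y) * (X 0 ^ a * x) := by ring
        rw [this]
        exact Ideal.mul_mem_mul (hX y hy) (h x hx)
      | add x _ y _ hx hy => rw [mul_add]; exact Ideal.add_mem _ hx hy
    have first : ∀ H ∈ tailIdeal k n ^ (r - 1), X 0 ^ (n - 1) * H ∈ I := by
      intro H hH
      refine le_standardJacobianIdeal ?_
      have : X 0 ^ (n - 1) * H = X 0 ^ (n - 2) * (X 0 * H) := by
        rw [← mul_assoc, ← pow_succ]; congr 2; omega
      rw [this]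
      exact Ideal.mul_mem_left _ _ (hX _ (Ideal.pow_le_self (by omega) hH))
    have hle : I ^ (t + 1) * J ≤ J * I ^ (t + 1) := by rw [mul_comm]
    rw [pow_succ]
    refine (Ideal.mul_mono_left ih).trans ?_
    rw [Ideal.sup_mul, Ideal.sup_mul]
    refine sup_le ?_ (sup_le ?_ ?_)
    · rw [mul_assoc, ← pow_succ]
      exact le_sup_left
    · conv_lhs => rw [hI, standardJacobianIdeal, Ideal.mul_sup, Ideal.mul_sup]
      refine sup_le ?_ (sup_le ?_ ?_)
      · refine le_trans (Ideal.mul_mono_left ?_) (hle.trans le_sup_left)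
        rw [Ideal.span_singleton_le_iff_mem]
        exact X_zero_pow_mem_pow (t + 1)
      · rw [Ideal.span_singleton_mul_span_singleton, ← pow_add,
          show n * (t + 1) + n = n * (t + 1 + 1) by ring]
        exact le_sup_left.trans le_sup_right
      · refine le_trans ?_ le_sup_left
        rw [Ideal.span_singleton_mul_le_iff]
        intro G hG
        have := mixed (n * t + (n - 1)) (r - 1) G (by rwa [Nat.sub_add_cancel (by omega)])
          (t + 1) (fun H hH => by
            rw [pow_add (X 0), mul_assoc, pow_succ I]
            exact Ideal.mul_mem_mul (X_zero_pow_mem_pow t) (first H hH))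
        rwa [show n * t + (n - 1) + 1 = n * (t + 1) by rw [mul_add]; omega] at this
    · conv_lhs => rw [hI, standardJacobianIdeal, Ideal.mul_sup, Ideal.mul_sup]
      refine sup_le ?_ (sup_le ?_ ?_)
      · exact le_trans (Ideal.mul_mono_left (tailIdeal_pow_le_pow (t + 1)))
          (hle.trans le_sup_left)
      · refine le_trans ?_ le_sup_left
        rw [mul_comm, Ideal.span_singleton_mul_le_iff]
        intro G hG
        have := mixed (n - 1) (r * t + (r - 1)) G
          (by rwa [show r * t + (r - 1) + 1 = r * (t + 1) by rw [mul_add]; omega])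
          (t + 1) (fun H hH => by
            rw [pow_add] at hH
            induction hH using Submodule.mul_induction_on' with
            | mem_mul_mem x hx y hy =>
              rw [mul_left_comm, pow_succ]
              exact Ideal.mul_mem_mul (tailIdeal_pow_le_pow t hx) (first y hy)
            | add x _ y _ hx hy => rw [mul_add]; exact Ideal.add_mem _ hx hy)
        rwa [Nat.sub_add_cancel (by omega)] at this
      · rw [← pow_add, show r * (t + 1) + r = r * (t + 1 + 1) by ring]
        exact le_sup_right.trans le_sup_right

theorem inf_standardJacobianIdeal_pow_le (hn : 2 ≤ n) (hr : 3 ≤ r) (t : ℕ) :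
    J ⊓ standardJacobianIdeal J r ^ (t + 1) ≤ J * standardJacobianIdeal J r ^ t := by
  rintro F ⟨hF, hF'⟩
  obtain ⟨F₁, hF₁, F₂, hF₂, rfl⟩ := Submodule.mem_sup.1
    (hJ.standardJacobianIdeal_pow_le hn (by omega) t hF')
  refine Ideal.add_mem _ hF₁ ?_
  have hF₂J : F₂ ∈ J := (Ideal.add_mem_iff_right _ (Ideal.mul_le_left hF₁)).1 hF
  have hsupp : ∀ s ∈ F₂.support, n * (t + 1) ≤ s 0 ∨ r * (t + 1) ≤ tailDegree s := by
    obtain ⟨A, hA, B, hB, rfl⟩ := Submodule.mem_sup.1 hF₂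
    obtain ⟨A, rfl⟩ := Ideal.mem_span_singleton'.1 hA
    intro s hs
    classical
    rcases Finset.mem_union.1 (support_add hs) with h | h
    · left
      rw [mem_support_iff, X_pow_eq_monomial, coeff_mul_monomial'] at h
      split_ifs at h with hle
      · exact Finsupp.single_le_iff.1 hle
      · exact absurd rfl h
    · exact Or.inr (mem_tailIdeal_pow_iff.1 hB s h)
  let u : Fin n := ⟨0, by omega⟩
  let v : Fin n := ⟨1, by omega⟩
  have huv : u ≠ v := by simp [u, v]
  refine hJ.mem_of_forall_isMixed hF₂J _ u v fun s hs hm => ?_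
  have hnt : n * (t + 1) = n * t + n := by ring
  have hrt : r * (t + 1) = r * t + r := by ring
  by_cases h0 : s 0 = 0
  · have ht : r * (t + 1) ≤ tailDegree s := (hsupp s hs).resolve_left (by
      rw [h0, hnt]; omega)
    have hd := degree_eq_add_tailDegree s
    refine Ideal.mul_mono_right ?_ (monomial_sub_mixedNormalForm_mem J
      (fun a b c hab => hJ.cubic_mem hab huv c) huv hm h0 (d := s.degree - 3) (by omega))
    -- Reduction to normal form costs three degrees, and r(t+1) − 3 ≥ rt because r ≥ 3.
    exact le_trans (Ideal.pow_le_pow_right (by omega)) (tailIdeal_pow_le_pow t)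
  · obtain ⟨i, w, hw0, hwt, hw⟩ := hm.monomial_eq_of_ne_zero (k := k) h0
    rw [mixedNormalForm, zero_pow h0, C_0, zero_mul, sub_zero, hw]
    refine Ideal.mul_mem_mul (hJ.X_zero_mul_X_mem i) ?_
    rcases hsupp s hs with h | h
    · obtain ⟨G, hG⟩ := monomial_eq_X_zero_pow_mul (k := k) (s := w) (a := n * t) (by omega)
      rw [hG]
      exact Ideal.mul_mem_right _ _ (X_zero_pow_mem_pow t)
    · exact tailIdeal_pow_le_pow t (monomial_mem_tailIdeal_pow (by omega) 1)

/-- A monomial of large degree is free of x₀ and lies in Tʳ, or is divisible by some x₀xᵢ, or is a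
power of x₀. -/
theorem mem_standardJacobianIdeal_of_isHomogeneous {F : MvPolynomial (Fin (n + 1)) k} {d : ℕ}
    (hF : F.IsHomogeneous d) (hn : n ≤ d) (hr : r ≤ d) : F ∈ standardJacobianIdeal J r := by
  rw [F.as_sum]
  refine Ideal.sum_mem _ fun s hs => ?_
  have hd : s.degree = d := (hF.degree_eq_sum_deg_support hs).symm
  rw [← mul_one (coeff s F), ← C_mul_monomial]
  refine Ideal.mul_mem_left _ _ ?_
  have := degree_eq_add_tailDegree s
  by_cases h0 : s 0 = 0
  · exact tailIdeal_pow_le_standardJacobianIdeal (monomial_mem_tailIdeal_pow (by omega) 1)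
  · by_cases hm : IsMixed s
    · obtain ⟨i, w, -, -, hw⟩ := hm.monomial_eq_of_ne_zero (k := k) h0
      rw [hw]
      exact Ideal.mul_mem_right _ _ (le_standardJacobianIdeal (hJ.X_zero_mul_X_mem i))
    · have ht : tailDegree s = 0 := by
        by_contra ht
        obtain ⟨i, _, hi⟩ := Finset.exists_ne_zero_of_sum_ne_zero ht
        exact hm ⟨0, i.succ, (Fin.succ_ne_zero i).symm, h0, hi⟩
      obtain ⟨G, hG⟩ := monomial_eq_X_zero_pow_mul (k := k) (s := s) (a := n) (by omega)
      rw [hG]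
      exact Ideal.mul_mem_right _ _ X_zero_pow_mem_standardJacobianIdeal

end IsStandardIdeal

end

theorem isHomogeneous_det {σ ι : Type*} [Fintype ι] [DecidableEq ι]
    (M : Matrix ι ι (MvPolynomial σ k)) (e : ι → ℕ)
    (h : ∀ i j, (M i j).IsHomogeneous (e i)) : M.det.IsHomogeneous (∑ i, e i) := by
  rw [Matrix.det_apply]
  refine IsHomogeneous.sum _ _ _ fun π _ => ?_
  have : (∏ i, M (π i) i).IsHomogeneous (∑ i, e i) := by
    rw [← Equiv.sum_comp π]
    exact IsHomogeneous.prod _ _ _ fun i _ => h _ _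
  rcases Int.units_eq_one_or (Equiv.Perm.sign π) with hs | hs <;> rw [hs]
  · simpa using this
  · simpa using this.neg

end MvPolynomial

/-! ### Separating determinants: the Jacobian ideal contains the explicit ideal. -/

namespace MvPolynomial

variable {k : Type*} [Field k] {n : ℕ}

theorem tailIdeal_pow_succ_le (q : ℕ) : tailIdeal k n ^ (q + 1) ≤
    Ideal.span {F | F.IsHomogeneous (q + 1) ∧ eval (Pi.single 0 1) F = 0} := by
  induction q with
  | zero =>
    rw [zero_add, pow_one, tailIdeal]
    refine Ideal.span_mono ?_
    rintro _ ⟨i, rfl⟩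
    exact ⟨isHomogeneous_X k _, by simp⟩
  | succ q ih =>
    rw [pow_succ]
    refine (Ideal.mul_mono_left ih).trans ?_
    rw [tailIdeal, Ideal.span_mul_span', Ideal.span_le]
    rintro _ ⟨F, ⟨hF, hF0⟩, _, ⟨i, rfl⟩, rfl⟩
    exact Ideal.subset_span ⟨hF.mul (isHomogeneous_X k _), by simp⟩

/-- The coefficient of xᵢᵈ in ∂ᵢF is a multiple of that of xᵢᵈ⁺¹ in F. -/
theorem eval_single_pderiv_of_isHomogeneous {F : MvPolynomial (Fin (n + 1)) k} {d : ℕ}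
    (hF : F.IsHomogeneous (d + 1)) (i : Fin (n + 1)) (h : eval (Pi.single i 1) F = 0) :
    eval (Pi.single i 1) (pderiv i F) = 0 := by
  rw [eval_single_of_isHomogeneous hF] at h
  have h1 : (pderiv i F).IsHomogeneous d := by simpa using hF.pderiv (i := i)
  rw [eval_single_of_isHomogeneous h1, coeff_pderiv, ← Finsupp.single_add, h, zero_mul]

/-- Auxiliary forms for the construction of forms in the Jacobian ideal that vanish at all but one
of the points. -/
theorem exists_separating_factors (hn : 2 ≤ n) (p : Fin n) :
    ∃ (y : ℕ) (Y Z : Fin n → MvPolynomial (Fin (n + 1)) k), 1 + (n - 1) * y = max n 3 ∧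
      ∀ a, a ≠ p → (Y a).IsHomogeneous y ∧ (Z a).IsHomogeneous y ∧
        pderiv 0 (Y a) = 0 ∧ pderiv 0 (Z a) = 0 ∧
        eval (Fin.cons 0 1 : Fin (n + 1) → k) (Y a) = 1 ∧
        eval (Fin.cons 0 1 : Fin (n + 1) → k) (Z a) = 0 ∧
        eval (Pi.single p.succ 1) (Y a) = 0 ∧ eval (Pi.single p.succ 1) (Z a) = 1 ∧
        eval (Pi.single a.succ 1) (Y a) = 0 ∧ eval (Pi.single a.succ 1) (Z a) = 0 := by
  have hX := fun i : Fin n => isHomogeneous_X k i.succ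
  rcases hn.eq_or_lt with rfl | hn
  -- For n = 2 there is no third index, so quadratic factors are needed; the determinant then has
  -- degree 3 rather than n.
  · refine ⟨2, fun a => X p.succ * X a.succ, fun a => X p.succ * (X p.succ - X a.succ), by simp,
      fun a ha => ⟨(hX p).mul (hX a), (hX p).mul ((hX p).sub (hX a)), ?_⟩⟩
    simp [pderiv_X, ha, ha.symm]
  · have : ∀ a : Fin n, ∃ b, b ≠ a ∧ b ≠ p := by
      intro a
      by_contra! h
      have h1 : (Finset.univ : Finset (Fin n)) ⊆ {a, p} := fun b _ => by
        by_cases hb : b = a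
        · simp [hb]
        · simp [h b hb]
      have h2 := (Finset.card_le_card h1).trans Finset.card_le_two
      rw [Finset.card_univ, Fintype.card_fin] at h2
      omega
    choose τ hτ hτ' using this
    refine ⟨1, fun a => X (τ a).succ, fun a => X p.succ - X (τ a).succ, by omega,
      fun a ha => ⟨hX _, (hX _).sub (hX _), ?_⟩⟩
    simp [pderiv_X, ha.symm, hτ, hτ']

section

variable (p : Fin n) (l : MvPolynomial (Fin (n + 1)) k) (A : Fin n → MvPolynomial (Fin (n + 1)) k)

/-- The determinant of the partial derivatives with respect to all variables but `X p.succ` of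
`X 0 * l` and the polynomials `A a` for `a ≠ p`. -/
noncomputable def separatingDet : MvPolynomial (Fin (n + 1)) k :=
  (Matrix.of fun a c => pderiv (if c = p then 0 else c.succ)
    (if a = p then X 0 * l else A a)).det

variable {p l A}

/-- At a coordinate point other than the one of index `p.succ`, the column of derivatives along that
same coordinate vanishes, because all rows come from forms in J. -/
theorem separatingDet_spec {J : Ideal (MvPolynomial (Fin (n + 1)) k)} (hJ : IsStandardIdeal J)
    {y : ℕ} (hl : l.IsHomogeneous 1) (hlJ : X 0 * l ∈ J)
    (hA : ∀ a, a ≠ p → (A a).IsHomogeneous (y + 1)) (hAJ : ∀ a, a ≠ p → A a ∈ J) :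
    separatingDet p l A ∈ jacobianIdeal n J ∧
      (separatingDet p l A).IsHomogeneous (1 + (n - 1) * y) ∧
      ∀ i, i ≠ p.succ → eval (Pi.single i 1) (separatingDet p l A) = 0 := by
  have hmem : ∀ a, (if a = p then X 0 * l else A a) ∈ J := by
    intro a
    split_ifs with h
    · exact hlJ
    · exact hAJ a h
  have hhom : ∀ a, (if a = p then X 0 * l else A a).IsHomogeneous
      ((if a = p then 1 else y) + 1) := by
    intro a
    split_ifs with h
    · exact (isHomogeneous_X k 0).mul hl
    · exact hA a h
  refine ⟨det_mem_jacobianIdeal hmem _, ?_, ?_⟩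
  · have := isHomogeneous_det (Matrix.of fun a c : Fin n => pderiv (if c = p then 0 else c.succ)
      (if a = p then X 0 * l else A a)) (fun a => if a = p then 1 else y)
      (fun a c => by simpa using (hhom a).pderiv)
    have e : ∑ a : Fin n, (if a = p then 1 else y) = 1 + (n - 1) * y := by
      rw [← Finset.add_sum_erase _ _ (Finset.mem_univ p), if_pos rfl,
        Finset.sum_congr rfl (g := fun _ => y) (fun a ha => if_neg (Finset.ne_of_mem_erase ha))]
      simp
    rwa [e] at this
  · intro i hi
    have key : ∀ c : Fin n, (if c = p then 0 else c.succ) = i →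
        eval (Pi.single i 1) (separatingDet p l A) = 0 := by
      intro c hc
      rw [separatingDet, RingHom.map_det]
      refine Matrix.det_eq_zero_of_column_eq_zero c fun a => ?_
      simp only [RingHom.mapMatrix_apply, Matrix.map_apply, Matrix.of_apply]
      rw [hc]
      exact eval_single_pderiv_of_isHomogeneous (hhom a) i
        (((hJ.mem_iff_of_isHomogeneous (hhom a)).1 (hmem a)).1 i)
    by_cases h0 : i = 0
    · exact key p (by simp [h0])
    · obtain ⟨c, rfl⟩ := Fin.exists_succ_eq.2 h0
      exact key c (if_neg (by rintro rfl; exact hi rfl))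

/-- On x₀ = 0 the column ∂/∂x₀ has `l` as its only possibly nonzero entry. -/
theorem eval_separatingDet_eq_zero {x : Fin (n + 1) → k} (hx : x 0 = 0)
    (hA : ∀ a, a ≠ p → pderiv 0 (A a) = 0) (hl : eval x l = 0) :
    eval x (separatingDet p l A) = 0 := by
  rw [separatingDet, RingHom.map_det]
  refine Matrix.det_eq_zero_of_column_eq_zero p fun a => ?_
  by_cases h : a = p
  · simp [h, hl, hx]
  · simp [h, hA a h]

theorem eval_separatingDet_ne_zero {x : Fin (n + 1) → k} (hx : x 0 = 0)
    (hA : ∀ a, a ≠ p → pderiv 0 (A a) = 0) (hl : eval x l ≠ 0) {ε : k} (hε : ε ≠ 0)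
    (hAx : ∀ a c, a ≠ p → c ≠ p → eval x (pderiv c.succ (A a)) = if a = c then ε else 0) :
    eval x (separatingDet p l A) ≠ 0 := by
  have : (eval x).mapMatrix (Matrix.of fun a c : Fin n => pderiv (if c = p then 0 else c.succ)
      (if a = p then X 0 * l else A a)) =
      Matrix.diagonal fun a => if a = p then eval x l else ε := by
    ext a c
    simp only [RingHom.mapMatrix_apply, Matrix.map_apply, Matrix.of_apply, Matrix.diagonal_apply]
    by_cases ha : a = p
    · subst ha
      by_cases hc : c = a
      · subst hc; simp [hx]
      · simp [hc, Ne.symm hc, hx, pderiv_X_of_ne (Fin.succ_ne_zero c).symm]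
    · by_cases hc : c = p
      · subst hc; simp [ha, hA a ha]
      · simp [ha, hc, hAx a c ha hc]
  rw [separatingDet, RingHom.map_det, this, Matrix.det_diagonal, Finset.prod_ne_zero_iff]
  intro a _
  split_ifs
  · exact hl
  · exact hε

end

/-- The points of a standard configuration that lie on the hyperplane `X 0 = 0`. -/
def standardPoint (k : Type*) [Field k] : Option (Fin n) → Fin (n + 1) → k
  | none => Fin.cons 0 1
  | some p => Pi.single p.succ 1

namespace IsStandardIdeal

variable {J : Ideal (MvPolynomial (Fin (n + 1)) k)} (hJ : IsStandardIdeal J)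
include hJ

theorem exists_separating_form (hn : 2 ≤ n) (P : Option (Fin n)) :
    ∃ G ∈ jacobianIdeal n J, G.IsHomogeneous (max n 3) ∧ eval (Pi.single 0 1) G = 0 ∧
      eval (standardPoint k P) G ≠ 0 ∧ ∀ Q, Q ≠ P → eval (standardPoint k Q) G = 0 := by
  have hX := fun i : Fin n => isHomogeneous_X k i.succ
  have hne : ∀ p : Fin n, ∃ j, j ≠ p := fun p => by
    have : Nontrivial (Fin n) := Fin.nontrivial_iff_two_le.2 hn
    exact exists_ne p
  cases P with
  | none =>
    -- The index `p` is auxiliary here: `l` is a variable that vanishes at that coordinate point but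
    -- not at (0 : 1 : ⋯ : 1).
    let p : Fin n := ⟨0, by omega⟩
    obtain ⟨j, hj⟩ := hne p
    obtain ⟨y, Y, Z, hy, h⟩ := exists_separating_factors (k := k) hn p
    let A : Fin n → MvPolynomial (Fin (n + 1)) k := fun a => Y a * (X p.succ - X a.succ)
    have hA : ∀ a, a ≠ p → (A a).IsHomogeneous (y + 1) := fun a ha =>
      (h a ha).1.mul ((hX p).sub (hX a))
    obtain ⟨h1, h2, h3⟩ := separatingDet_spec (p := p) (l := X j.succ) (A := A) hJ (hX j)
      (hJ.X_zero_mul_X_mem j) hA (fun a ha => by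
        obtain ⟨_, _, _, _, e1, e2, e3, e4, e5, e6⟩ := h a ha
        rw [hJ.mem_iff_of_isHomogeneous (hA a ha)]
        refine ⟨fun i => ?_, by simp [A]⟩
        by_cases hip : i = p.succ
        · subst hip; simp [A, e3]
        · by_cases hia : i = a.succ
          · subst hia; simp [A, e5]
          · simp [A, Ne.symm hip, Ne.symm hia])
    have hA0 : ∀ a, a ≠ p → pderiv 0 (A a) = 0 := fun a ha => by
      simp [A, (h a ha).2.2.1]
    refine ⟨_, h1, hy ▸ h2, h3 0 (Fin.succ_ne_zero p).symm, ?_, ?_⟩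
    · refine eval_separatingDet_ne_zero (by simp [standardPoint]) hA0 (by simp [standardPoint])
        (neg_ne_zero.2 one_ne_zero) ?_
      intro a c ha hc
      simp [A, standardPoint, pderiv_X, Pi.single_apply, Ne.symm hc]
      split_ifs <;> simp [(h a ha).2.2.2.2.1]
    · rintro (_ | q) hq
      · exact absurd rfl hq
      · by_cases hqp : q = p
        · subst hqp
          refine eval_separatingDet_eq_zero ?_ hA0 ?_
          · simp [standardPoint]
          · simp [standardPoint, hj]
        · exact h3 _ fun h => hqp (Fin.succ_injective _ h)
  | some p =>
    obtain ⟨j, hj⟩ := hne p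
    obtain ⟨y, Y, Z, hy, h⟩ := exists_separating_factors (k := k) hn p
    -- At the coordinate point of `p` the factor `X a.succ` vanishes and `Z a` is 1, so
    -- differentiation leaves an identity block; `l = X p.succ - X j.succ` is nonzero there and
    -- vanishes at (0 : 1 : ⋯ : 1).
    let A : Fin n → MvPolynomial (Fin (n + 1)) k := fun a => Z a * X a.succ
    have hA : ∀ a, a ≠ p → (A a).IsHomogeneous (y + 1) := fun a ha => (h a ha).2.1.mul (hX a)
    obtain ⟨h1, h2, h3⟩ := separatingDet_spec (p := p) (l := X p.succ - X j.succ) (A := A) hJ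
      ((hX p).sub (hX j)) (by
        rw [mul_sub]
        exact J.sub_mem (hJ.X_zero_mul_X_mem p) (hJ.X_zero_mul_X_mem j))
      hA (fun a ha => by
        obtain ⟨_, _, _, _, e1, e2, e3, e4, e5, e6⟩ := h a ha
        rw [hJ.mem_iff_of_isHomogeneous (hA a ha)]
        refine ⟨fun i => ?_, by simp [A, e2]⟩
        by_cases hia : i = a.succ
        · subst hia; simp [A, e6]
        · simp [A, Ne.symm hia])
    have hA0 : ∀ a, a ≠ p → pderiv 0 (A a) = 0 := fun a ha => by
      simp [A, (h a ha).2.2.2.1]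
    refine ⟨_, h1, hy ▸ h2, h3 0 (Fin.succ_ne_zero p).symm, ?_, ?_⟩
    · refine eval_separatingDet_ne_zero (by simp [standardPoint]) hA0
        (by simp [standardPoint, hj]) one_ne_zero ?_
      intro a c ha hc
      simp [A, standardPoint, pderiv_X, Pi.single_apply, ha]
      split_ifs <;> simp [(h a ha).2.2.2.2.2.2.2.1]
    · rintro (_ | q) hq
      · exact eval_separatingDet_eq_zero (by simp [standardPoint]) hA0 (by simp [standardPoint])
      · exact h3 _ fun h => hq (congrArg some (Fin.succ_injective _ h))

/-- Lagrange interpolation: a form `w` of degree r vanishing at the first coordinate point agrees at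
every point of the configuration with a combination `S` of separating forms, so `w - S` lies in J.
-/
theorem tailIdeal_pow_le_jacobianIdeal (hn : 2 ≤ n) :
    tailIdeal k n ^ max n 3 ≤ jacobianIdeal n J := by
  obtain ⟨q, hq⟩ : ∃ q, max n 3 = q + 1 := ⟨max n 3 - 1, by omega⟩
  choose G hG hGh hG0 hG1 hG2 using hJ.exists_separating_form hn
  rw [hq] at hGh ⊢
  refine (tailIdeal_pow_succ_le q).trans (Ideal.span_le.2 ?_)
  rintro w ⟨hw, hw0⟩
  set S := ∑ P, C (eval (standardPoint k P) w / eval (standardPoint k P) (G P)) * G P with hS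
  have hSJ : S ∈ jacobianIdeal n J := Ideal.sum_mem _ fun P _ => Ideal.mul_mem_left _ _ (hG P)
  have hSh : S.IsHomogeneous (q + 1) := IsHomogeneous.sum _ _ _ fun P _ => (hGh P).C_mul _
  have hSe : ∀ Q, eval (standardPoint k Q) S = eval (standardPoint k Q) w := by
    intro Q
    rw [hS, map_sum, Finset.sum_eq_single Q]
    · simp [hG1 Q]
    · intro P _ hP
      simp [hG2 P Q hP.symm]
    · simp
  have : w - S ∈ J := by
    rw [hJ.mem_iff_of_isHomogeneous (hw.sub hSh)]
    refine ⟨fun i => ?_, ?_⟩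
    · by_cases hi : i = 0
      · subst hi
        rw [map_sub, hw0, hS]
        simp [hG0]
      · obtain ⟨c, rfl⟩ := Fin.exists_succ_eq.2 hi
        have := hSe (some c)
        simp only [standardPoint] at this
        rw [map_sub, this, sub_self]
    · have := hSe none
      simp only [standardPoint] at this
      rw [map_sub, this, sub_self]
  have h := Ideal.add_mem _ (le_jacobianIdeal n J this) hSJ
  rwa [sub_add_cancel] at h

theorem standardJacobianIdeal_le_jacobianIdeal (hn : 2 ≤ n) :
    standardJacobianIdeal J (max n 3) ≤ jacobianIdeal n J := by
  refine sup_le (le_jacobianIdeal n J) (sup_le ?_ (hJ.tailIdeal_pow_le_jacobianIdeal hn))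
  rw [Ideal.span_singleton_le_iff_mem]
  -- The derivatives of the quadrics x₀xₐ along x₁, …, xₙ form x₀ times the identity matrix, whence
  -- x₀ⁿ.
  have := det_mem_jacobianIdeal (n := n) (J := J) (F := fun a => X 0 * X a.succ)
    hJ.X_zero_mul_X_mem (fun c => pderiv c.succ)
  have e : (Matrix.of fun a c : Fin n => pderiv c.succ (X 0 * X a.succ)) =
      Matrix.diagonal fun _ => (X 0 : MvPolynomial (Fin (n + 1)) k) := by
    ext1 a c
    simp [Matrix.diagonal_apply, pderiv_X, Pi.single_apply]
  rw [e, Matrix.det_diagonal] at this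
  simpa using this

/-! ### Generators of J: the Jacobian ideal is contained in the explicit ideal. -/

theorem le_of_generators_mem (N : Ideal (MvPolynomial (Fin (n + 1)) k)) {u v : Fin n}
    (huv : u ≠ v) (h0 : ∀ i : Fin n, X 0 * X i.succ ∈ N)
    (h2 : ∀ a b : Fin n, a ≠ b → X a.succ * X b.succ - X u.succ * X v.succ ∈ N)
    (h3 : ∀ a b c : Fin n, a ≠ b →
      X a.succ * X b.succ * X c.succ - X u.succ * X u.succ * X v.succ ∈ N) : J ≤ N := by
  intro F hF
  refine hJ.mem_of_forall_isMixed hF N u v fun s _ hs => ?_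
  by_cases hs0 : s 0 = 0
  · by_cases hd : 3 ≤ s.degree
    · exact Ideal.mul_le_left (monomial_sub_mixedNormalForm_mem N h3 huv hs hs0
        (d := s.degree - 3) (by omega))
    · obtain ⟨a, b, w, hab, hw0, rfl⟩ := hs.exists_eq_add hs0
      have hw : w = 0 := by
        rw [← Finsupp.degree_eq_zero_iff]
        simp only [map_add, Finsupp.degree_single] at hd
        omega
      subst hw
      rw [mixedNormalForm, monomial_single_add_single_add, hs0]
      simpa using h2 a b hab
  · obtain ⟨i, w, -, -, hw⟩ := hs.monomial_eq_of_ne_zero (k := k) hs0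
    rw [mixedNormalForm, zero_pow hs0, C_0, zero_mul, sub_zero, hw]
    exact Ideal.mul_mem_right _ _ (h0 i)

/-- For n ≥ 3 the quadrics in J generate it, so the minors to be tested are forms of degree n. -/
theorem jacobianIdeal_le_of_three_le (hn : 3 ≤ n) :
    jacobianIdeal n J ≤ standardJacobianIdeal J n := by
  have hX := fun i : Fin n => isHomogeneous_X k i.succ
  set G : Set (MvPolynomial (Fin (n + 1)) k) := {F | F ∈ J ∧ F.IsHomogeneous 2} with hG
  have hGJ : Ideal.span G ≤ J := Ideal.span_le.2 fun F hF => hF.1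
  let u : Fin n := ⟨0, by omega⟩
  let v : Fin n := ⟨1, by omega⟩
  let t : Fin n := ⟨2, by omega⟩
  have huv : u ≠ v := by simp [u, v]
  have hut : u ≠ t := by simp [u, t]
  have hvt : v ≠ t := by simp [v, t]
  have h2 : ∀ a b c d : Fin n, a ≠ b → c ≠ d →
      X a.succ * X b.succ - X c.succ * X d.succ ∈ Ideal.span G := by
    intro a b c d hab hcd
    have hh := ((hX a).mul (hX b)).sub ((hX c).mul (hX d))
    refine Ideal.subset_span ⟨?_, hh⟩
    rw [hJ.mem_iff_of_isHomogeneous hh]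
    refine ⟨fun j => ?_, by simp⟩
    simp only [Pi.single_apply, map_sub, map_mul, eval_X]
    have h1 : ¬ (a.succ = j ∧ b.succ = j) := fun h =>
      hab (Fin.succ_injective _ (h.1.trans h.2.symm))
    have h2 : ¬ (c.succ = j ∧ d.succ = j) := fun h =>
      hcd (Fin.succ_injective _ (h.1.trans h.2.symm))
    split_ifs <;> simp_all
  have hle : J ≤ Ideal.span G := by
    refine hJ.le_of_generators_mem _ huv
      (fun i => Ideal.subset_span ⟨hJ.X_zero_mul_X_mem i, (isHomogeneous_X k 0).mul (hX i)⟩)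
      (fun a b hab => h2 a b u v hab huv) ?_
    intro a b c hab
    have e1 := Ideal.mul_mem_left _ (X c.succ) (h2 a b u v hab huv)
    have e2 : X c.succ * (X u.succ * X v.succ) - X u.succ * X u.succ * X v.succ ∈
        Ideal.span G := by
      by_cases hcv : c = v
      · subst hcv
        -- A third index `t` is needed to pass from xᵤxᵥ² to xᵤ²xᵥ by way of xᵤxᵥxₜ.
        convert Ideal.add_mem _ (Ideal.mul_mem_left _ (X v.succ) (h2 u v u t huv hut))
          (Ideal.mul_mem_left _ (X u.succ) (h2 v t u v hvt huv)) using 1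
        ring
      · convert Ideal.mul_mem_left _ (X u.succ) (h2 c v u v hcv huv) using 1
        ring
    convert Ideal.add_mem _ e1 e2 using 1
    ring
  rw [le_antisymm hle hGJ]
  refine jacobianIdeal_le G _ le_standardJacobianIdeal ?_
  rw [← le_antisymm hle hGJ]
  intro F hF b
  refine hJ.mem_standardJacobianIdeal_of_isHomogeneous (d := n)
    ?_ le_rfl le_rfl
  simpa using isHomogeneous_det (Matrix.of fun a c : Fin n => pderiv (b c) (F a)) (fun _ => 1)
    (fun a c => (hF a).2.pderiv)

end IsStandardIdeal

/-- In the plane a cubic generator is unavoidable. A minor of the two quadrics lies in (x₀x₁, x₀x₂,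
x₀²); a minor involving a cubic has degree at least 3. -/
theorem IsStandardIdeal.jacobianIdeal_two_le {J : Ideal (MvPolynomial (Fin 3) k)}
    (hJ : IsStandardIdeal (n := 2) J) :
    jacobianIdeal 2 J ≤ standardJacobianIdeal (n := 2) J 3 := by
  have hX := fun i : Fin 2 => isHomogeneous_X k i.succ
  set G : Set (MvPolynomial (Fin 3) k) :=
    (Set.range fun i : Fin 2 => X 0 * X i.succ) ∪ {F | F ∈ J ∧ F.IsHomogeneous 3} with hG
  have hGJ : Ideal.span G ≤ J := by
    refine Ideal.span_le.2 ?_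
    rintro _ (⟨i, rfl⟩ | hF)
    · exact hJ.X_zero_mul_X_mem i
    · exact hF.1
  have h01 : (0 : Fin 2) ≠ 1 := by simp
  have hle : J ≤ Ideal.span G := by
    refine hJ.le_of_generators_mem _ h01 (fun i => Ideal.subset_span (Or.inl ⟨i, rfl⟩)) ?_ ?_
    · intro a b hab
      have : (X a.succ * X b.succ : MvPolynomial (Fin 3) k) =
          X (0 : Fin 2).succ * X (1 : Fin 2).succ := by
        fin_cases a <;> fin_cases b
        · exact absurd rfl hab
        · rfl
        · exact mul_comm _ _
        · exact absurd rfl hab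
      rw [this, sub_self]
      exact Ideal.zero_mem _
    · intro a b c hab
      exact Ideal.subset_span (Or.inr ⟨hJ.cubic_mem hab h01 c,
        (((hX a).mul (hX b)).mul (hX c)).sub (((hX 0).mul (hX 0)).mul (hX 1))⟩)
  rw [le_antisymm hle hGJ]
  refine jacobianIdeal_le G _ le_standardJacobianIdeal ?_
  rw [← le_antisymm hle hGJ]
  intro F hF b
  by_cases hq : ∀ a, F a ∈ Set.range fun i : Fin 2 => (X 0 * X i.succ : MvPolynomial (Fin 3) k)
  · choose i hi using hq
    have h0 : ∀ i : Fin 2, X 0 * X i.succ ∈ standardJacobianIdeal (n := 2) J 3 := fun i =>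
      le_standardJacobianIdeal (hJ.X_zero_mul_X_mem i)
    have h2 : X 0 ^ 2 ∈ standardJacobianIdeal (n := 2) J 3 := X_zero_pow_mem_standardJacobianIdeal
    rw [Matrix.det_fin_two]
    simp only [Matrix.of_apply, ← hi, pderiv_mul]
    convert Ideal.add_mem _ (Ideal.add_mem _
      (Ideal.mul_mem_left _ (pderiv (b 0) (X 0) * pderiv (b 1) (X (i 1).succ) -
        pderiv (b 1) (X 0) * pderiv (b 0) (X (i 1).succ)) (h0 (i 0)))
      (Ideal.mul_mem_left _ (pderiv (b 0) (X (i 0).succ) * pderiv (b 1) (X 0) -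
        pderiv (b 1) (X (i 0).succ) * pderiv (b 0) (X 0)) (h0 (i 1))))
      (Ideal.mul_mem_left _ (pderiv (b 0) (X (i 0).succ) * pderiv (b 1) (X (i 1).succ) -
        pderiv (b 1) (X (i 0).succ) * pderiv (b 0) (X (i 1).succ)) h2) using 1
    ring
  · push Not at hq
    obtain ⟨a₀, ha₀⟩ := hq
    -- Here `e` is the degree of the derivatives in row `a`, one less than that of `F a`.
    have hdeg : ∀ a, ∃ e, 1 ≤ e ∧ (a = a₀ → 2 ≤ e) ∧ (F a).IsHomogeneous (e + 1) := by
      intro a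
      rcases hF a with h | h
      · obtain ⟨i, hi⟩ := id h
        refine ⟨1, le_rfl, ?_, hi ▸ (isHomogeneous_X k 0).mul (hX i)⟩
        rintro rfl
        exact absurd h ha₀
      · exact ⟨2, by simp, fun _ => le_rfl, h.2⟩
    choose e he1 he2 he using hdeg
    have hsum : 3 ≤ ∑ a, e a := by
      rw [← Finset.add_sum_erase _ _ (Finset.mem_univ a₀)]
      have h1 := he2 a₀ rfl
      have h2 : (Finset.univ.erase a₀).card • 1 ≤ ∑ a ∈ Finset.univ.erase a₀, e a :=
        Finset.card_nsmul_le_sum _ _ _ fun a _ => he1 a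
      simp at h2
      omega
    refine hJ.mem_standardJacobianIdeal_of_isHomogeneous
      (isHomogeneous_det _ e fun a c => ?_) (by omega) hsum
    simpa using (he a).pderiv

theorem IsStandardIdeal.jacobianIdeal_eq {J : Ideal (MvPolynomial (Fin (n + 1)) k)}
    (hJ : IsStandardIdeal J) (hn : 2 ≤ n) :
    jacobianIdeal n J = standardJacobianIdeal J (max n 3) := by
  refine le_antisymm ?_ (hJ.standardJacobianIdeal_le_jacobianIdeal hn)
  rcases hn.eq_or_lt with rfl | hn
  · exact hJ.jacobianIdeal_two_le
  · rw [max_eq_left (by omega)]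
    exact hJ.jacobianIdeal_le_of_three_le (by omega)

theorem IsStandardIdeal.inf_jacobianIdeal_pow_le {J : Ideal (MvPolynomial (Fin (n + 1)) k)}
    (hJ : IsStandardIdeal J) (hn : 2 ≤ n) {t : ℕ} (ht : 1 ≤ t) :
    J ⊓ jacobianIdeal n J ^ t ≤ J * jacobianIdeal n J ^ (t - 1) := by
  obtain ⟨t, rfl⟩ := Nat.exists_eq_add_of_le' ht
  rw [hJ.jacobianIdeal_eq hn]
  exact hJ.inf_standardJacobianIdeal_pow_le hn (le_max_right n 3) t

end MvPolynomial

/-! ### Homogeneous ideals of points and linear substitutions. -/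

namespace MvPolynomial

variable {k σ : Type*} [Field k]

theorem IsHomogeneous.eval_smul_eq [Fintype σ] {F : MvPolynomial σ k} {d : ℕ}
    (hF : F.IsHomogeneous d) (c : k) (x : σ → k) : eval (c • x) F = c ^ d * eval x F := by
  rw [eval_eq', eval_eq', Finset.mul_sum]
  refine Finset.sum_congr rfl fun s hs => ?_
  have hd : s.degree = d := (hF.degree_eq_sum_deg_support hs).symm
  simp only [Pi.smul_apply, smul_eq_mul, mul_pow]
  rw [Finset.prod_mul_distrib, Finset.prod_pow_eq_pow_sum, ← Finsupp.degree_eq_sum, hd]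
  ring

/-- The span is a homogeneous ideal inside the kernel of evaluation, so every component of a member
vanishes at `x`. -/
theorem mem_span_isHomogeneous_iff (x : σ → k) (F : MvPolynomial σ k) :
    F ∈ Ideal.span {F : MvPolynomial σ k | (∃ d : ℕ, F.IsHomogeneous d) ∧ eval x F = 0} ↔
      ∀ d, eval x (homogeneousComponent d F) = 0 := by
  constructor
  · intro hF d
    let : GradedAlgebra (homogeneousSubmodule σ k) := gradedAlgebra
    have h := homogeneousComponent_mem_of_mem (Ideal.homogeneous_span _ _ (by
      rintro G ⟨⟨d, hd⟩, -⟩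
      exact ⟨d, hd⟩)) hF d
    have hle : Ideal.span {F : MvPolynomial σ k | (∃ d : ℕ, F.IsHomogeneous d) ∧ eval x F = 0} ≤
        RingHom.ker (eval x) := Ideal.span_le.2 fun G hG => hG.2
    exact hle h
  · intro h
    rw [← sum_homogeneousComponent F]
    exact Ideal.sum_mem _ fun d _ => Ideal.subset_span
      ⟨⟨d, homogeneousComponent_isHomogeneous d F⟩, h d⟩

section LinearSubstitution

variable [Fintype σ]

/-- The substitution of the `j`-th variable by the linear form with coefficients in the `j`-th
column of a matrix. -/
noncomputable def linearSubst (A : Matrix σ σ k) : MvPolynomial σ k →ₐ[k] MvPolynomial σ k :=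
  aeval fun j => ∑ i, C (A i j) * X i

theorem linearSubst_X (A : Matrix σ σ k) (j : σ) :
    linearSubst A (X j) = ∑ i, C (A i j) * X i := by
  simp [linearSubst]

theorem linearSubst_comp (A B : Matrix σ σ k) :
    (linearSubst A).comp (linearSubst B) = linearSubst (A * B) := by
  refine algHom_ext fun j => ?_
  rw [AlgHom.comp_apply, linearSubst_X, linearSubst_X, map_sum]
  have : ∀ i, linearSubst A (C (B i j) * X i) = ∑ l, C (A l i * B i j) * X l := by
    intro i
    rw [map_mul, linearSubst_X, Finset.mul_sum, ← algebraMap_eq, AlgHom.commutes, algebraMap_eq]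
    refine Finset.sum_congr rfl fun l _ => ?_
    rw [C_mul]
    ring
  simp_rw [this, Matrix.mul_apply, map_sum, Finset.sum_mul]
  exact Finset.sum_comm

theorem linearSubst_one [DecidableEq σ] : linearSubst (1 : Matrix σ σ k) = AlgHom.id k _ := by
  refine algHom_ext fun j => ?_
  rw [linearSubst_X, Finset.sum_eq_single j]
  · simp
  · intro i _ hi
    simp [Matrix.one_apply_ne hi]
  · simp

/-- The linear substitution given by an invertible matrix. -/
noncomputable def linearSubstEquiv [DecidableEq σ] (A : (Matrix σ σ k)ˣ) :
    MvPolynomial σ k ≃ₐ[k] MvPolynomial σ k :=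
  AlgEquiv.ofAlgHom (linearSubst A.1) (linearSubst A⁻¹.1)
    (by rw [linearSubst_comp, Units.mul_inv, linearSubst_one])
    (by rw [linearSubst_comp, Units.inv_mul, linearSubst_one])

/-- On points the substitution is x ↦ xA; it sends the i-th coordinate vector to row i, so a matrix
with prescribed rows moves the coordinate points to prescribed vectors. -/
theorem eval_linearSubst (A : Matrix σ σ k) (x : σ → k) (F : MvPolynomial σ k) :
    eval x (linearSubst A F) = eval (∑ i, x i • A i) F := by
  induction F using MvPolynomial.induction_on with
  | C a => rw [← algebraMap_eq, AlgHom.commutes, algebraMap_eq, eval_C, eval_C]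
  | add p q hp hq => rw [map_add, map_add, map_add, hp, hq]
  | mul_X p j hp =>
    rw [map_mul, map_mul, map_mul, hp, linearSubst_X]
    simp [mul_comm]

theorem homogeneousComponent_linearSubst (A : Matrix σ σ k) (d : ℕ) (F : MvPolynomial σ k) :
    homogeneousComponent d (linearSubst A F) = linearSubst A (homogeneousComponent d F) := by
  have hh : ∀ e, (linearSubst A (homogeneousComponent e F)).IsHomogeneous e := fun e => by
    have := (homogeneousComponent_isHomogeneous e F).aeval (n := 1)
      (fun j => ∑ i, C (A i j) * X i : σ → MvPolynomial σ k)
      (fun j => IsHomogeneous.sum _ _ _ fun i _ => isHomogeneous_C_mul_X _ _)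
    rwa [one_mul] at this
  conv_lhs => rw [← sum_homogeneousComponent F]
  rw [map_sum, map_sum]
  simp_rw [homogeneousComponent_of_mem (hh _)]
  rw [Finset.sum_ite_eq]
  split_ifs with h
  · rfl
  · rw [homogeneousComponent_eq_zero, map_zero]
    simpa using h

end LinearSubstitution

end MvPolynomial

/-! ### Coordinates adapted to Γ, and the conclusion. -/

open MvPolynomial

theorem mem_idealOfPoints_iff {k : Type*} [Field k] {n : ℕ}
    {Γ : Finset (ℙ k (Fin (n + 1) → k))} {F : MvPolynomial (Fin (n + 1)) k} :
    F ∈ idealOfPoints Γ ↔ ∀ p ∈ Γ, ∀ d, eval p.rep (homogeneousComponent d F) = 0 := by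
  simp only [idealOfPoints, Submodule.mem_iInf, idealOfPoint]
  exact forall₂_congr fun p _ => mem_span_isHomogeneous_iff p.rep F

theorem Submodule.exists_le_and_finrank_add_one_eq {k V : Type*} [Field k] [AddCommGroup V]
    [Module k V] [FiniteDimensional k V] {L H : Submodule k V} (h : L < H) :
    ∃ L', L ≤ L' ∧ L' ≤ H ∧ Module.finrank k L' + 1 = Module.finrank k H := by
  have hlt : L.submoduleOf H < ⊤ := by
    rw [lt_top_iff_ne_top, Ne, Submodule.submoduleOf_eq_top]
    exact not_le_of_gt h
  obtain ⟨f, hf, hle⟩ := Submodule.exists_le_ker_of_lt_top _ hlt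
  refine ⟨(LinearMap.ker f).map H.subtype, ?_, Submodule.map_subtype_le _ _, ?_⟩
  · intro x hx
    exact ⟨⟨x, h.le hx⟩, hle hx, rfl⟩
  · rw [LinearEquiv.finrank_eq (Submodule.equivMapOfInjective H.subtype
      H.injective_subtype (LinearMap.ker f)).symm]
    exact Module.Dual.finrank_ker_add_one_of_ne_zero hf

/-- General position excludes only hyperplanes of `W`; any proper subspace extends to one. -/
theorem InGeneralLinearPosition.eq_of_forall_le {k V : Type*} [Field k] [AddCommGroup V]
    [Module k V] [FiniteDimensional k V] {W : Submodule k V} {S T : Finset (ℙ k V)}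
    (hS : InGeneralLinearPosition W S) (hcard : Module.finrank k W ≤ S.card) (hTS : T ⊆ S)
    (hT : T.card = Module.finrank k W) {L : Submodule k V} (hLW : L ≤ W)
    (hL : ∀ p ∈ T, p.submodule ≤ L) : L = W := by
  by_contra hne
  obtain ⟨L', hLL', hL'W, hr⟩ :=
    Submodule.exists_le_and_finrank_add_one_eq (lt_of_le_of_ne hLW hne)
  exact (hS.2.resolve_left fun h => absurd h.1 (not_lt_of_ge hcard)).2 T hTS hT L' hL'W hr
    fun p hp => (hL p hp).trans hLL'

theorem Projectivization.submodule_le_iff {k V : Type*} [Field k] [AddCommGroup V] [Module k V]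
    (p : ℙ k V) (L : Submodule k V) : p.submodule ≤ L ↔ p.rep ∈ L := by
  rw [Projectivization.submodule_eq, Submodule.span_singleton_le_iff_mem]

/-- A finite set of `n + 2` points in hyperplane linear position is, in suitable coordinates, the
set of the coordinate points and of `(0 : 1 : ⋯ : 1)`. -/
theorem InHyperplaneLinearPosition.exists_linearIndependent {k : Type*} [Field k] {n : ℕ}
    {Γ : Finset (ℙ k (Fin (n + 1) → k))} (hΓ : InHyperplaneLinearPosition Γ)
    (hcard : Γ.card = n + 2) :
    ∃ (v : Fin (n + 1) → Fin (n + 1) → k) (q w : ℙ k (Fin (n + 1) → k))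
      (P : Fin n → ℙ k (Fin (n + 1) → k)), LinearIndependent k v ∧
      (∀ p, p ∈ Γ ↔ p = q ∨ p = w ∨ ∃ i, p = P i) ∧ v 0 = q.rep ∧
      (∀ i, ∃ c : k, c ≠ 0 ∧ v i.succ = c • (P i).rep) ∧ ∑ i : Fin n, v i.succ = w.rep := by
  classical
  obtain ⟨-, Δ, q, hq, H, rfl, hH, -, hΔ, hqH⟩ := hΓ
  have hΔc : Δ.card = n + 1 := by rwa [Finset.card_cons, add_left_inj] at hcard
  have hspan : ∀ T ⊆ Δ, T.card = n → ∀ L ≤ H, (∀ p ∈ T, p.submodule ≤ L) → L = H :=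
    fun T hT hTc L hL h => hΔ.eq_of_forall_le (by omega) hT (hTc.trans hH.symm) hL h
  have hΔH : ∀ p ∈ Δ, p.rep ∈ H := fun p hp => (p.submodule_le_iff H).1 (hΔ.1 p hp)
  obtain ⟨w, hw⟩ : Δ.Nonempty := Finset.card_pos.1 (by omega)
  have hec : (Δ.erase w).card = n := by rw [Finset.card_erase_of_mem hw, hΔc]; rfl
  let e := (Finset.equivFinOfCardEq hec).symm
  let P : Fin n → ℙ k (Fin (n + 1) → k) := fun i => e i
  have hPmem : ∀ i, P i ∈ Δ.erase w := fun i => (e i).2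
  have hPsurj : ∀ p ∈ Δ.erase w, ∃ i, p = P i := fun p hp =>
    ⟨e.symm ⟨p, hp⟩, by simp [P]⟩
  have hPΔ : ∀ i, P i ∈ Δ := fun i => Finset.mem_of_mem_erase (hPmem i)
  let r : Fin n → Fin (n + 1) → k := fun i => (P i).rep
  have hr : Submodule.span k (Set.range r) = H := by
    refine hspan _ (Finset.erase_subset w Δ) hec _ ?_ ?_
    · rw [Submodule.span_le]
      rintro _ ⟨i, rfl⟩
      exact hΔH _ (hPΔ i)
    · intro p hp
      obtain ⟨i, rfl⟩ := hPsurj p hp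
      rw [Projectivization.submodule_le_iff]
      exact Submodule.subset_span ⟨i, rfl⟩
  have hrli : LinearIndependent k r := by
    rw [linearIndependent_iff_card_eq_finrank_span, Set.finrank, hr, hH, Fintype.card_fin]
  obtain ⟨c, hc⟩ : ∃ c : Fin n → k, ∑ i, c i • r i = w.rep := by
    rw [← Submodule.mem_span_range_iff_exists_fun, hr]
    exact hΔH w hw
  -- If `c i` were zero, the n points of `Δ` other than `P i` would lie in the span of the remaining
  -- `r j`; that span would be `H`, against the independence of `r`.
  have hc0 : ∀ i, c i ≠ 0 := by
    intro i hi
    have hL : Submodule.span k (r '' {i}ᶜ) = H := by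
      refine hspan (Δ.erase (P i)) (Finset.erase_subset _ _)
        (by rw [Finset.card_erase_of_mem (hPΔ i), hΔc]; rfl) _ ?_ ?_
      · rw [← hr]
        exact Submodule.span_mono (Set.image_subset_range _ _)
      · intro p hp
        rw [Projectivization.submodule_le_iff]
        have hmem : ∀ j, j ≠ i → r j ∈ Submodule.span k (r '' {i}ᶜ) := fun j hj =>
          Submodule.subset_span ⟨j, hj, rfl⟩
        by_cases hpw : p = w
        · rw [hpw, ← hc]
          refine Submodule.sum_mem _ fun j _ => ?_
          by_cases hj : j = i
          · simp [hj, hi]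
          · exact Submodule.smul_mem _ _ (hmem j hj)
        · obtain ⟨j, rfl⟩ := hPsurj p (Finset.mem_erase.2 ⟨hpw, Finset.mem_of_mem_erase hp⟩)
          exact hmem j fun hj => Finset.ne_of_mem_erase hp (by rw [hj])
    refine hrli.notMem_span_image (s := {i}ᶜ) (x := i) (by simp) ?_
    rw [hL]
    exact hΔH _ (hPΔ i)
  -- Rescaling by the `c i` turns `w` into the point with all coordinates 1 in `H`.
  refine ⟨Fin.cons q.rep fun i => c i • r i, q, w, P, ?_, ?_, by simp,
    fun i => ⟨c i, hc0 i, by simp [r]⟩, by simpa using hc⟩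
  · rw [linearIndependent_finCons]
    refine ⟨hrli.units_smul fun i => Units.mk0 (c i) (hc0 i), fun h => hqH ?_⟩
    rw [Projectivization.submodule_le_iff]
    refine (Submodule.span_le.2 ?_ : _ ≤ H) h
    rintro _ ⟨i, rfl⟩
    exact H.smul_mem _ (hΔH _ (hPΔ i))
  · intro p
    rw [Finset.mem_cons]
    refine or_congr_right ⟨fun hp => ?_, ?_⟩
    · by_cases hpw : p = w
      · exact Or.inl hpw
      · exact Or.inr (hPsurj p (Finset.mem_erase.2 ⟨hpw, hp⟩))
    · rintro (rfl | ⟨i, rfl⟩)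
      · exact hw
      · exact hPΔ i

theorem InHyperplaneLinearPosition.exists_isStandardIdeal_map {k : Type*} [Field k] {n : ℕ}
    {Γ : Finset (ℙ k (Fin (n + 1) → k))} (hΓ : InHyperplaneLinearPosition Γ)
    (hcard : Γ.card = n + 2) :
    ∃ e : MvPolynomial (Fin (n + 1)) k ≃ₐ[k] MvPolynomial (Fin (n + 1)) k,
      IsStandardIdeal ((idealOfPoints Γ).map e) := by
  obtain ⟨v, q, w, P, hv, hmem, h0, h1, h2⟩ := hΓ.exists_linearIndependent hcard
  have hu : IsUnit (Matrix.of v) := Matrix.linearIndependent_rows_iff_isUnit.1 hv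
  obtain ⟨A, hA⟩ := hu
  refine ⟨linearSubstEquiv A, fun F => ?_⟩
  obtain ⟨F, rfl⟩ := (linearSubstEquiv A).surjective F
  have hiff : linearSubstEquiv A F ∈ (idealOfPoints Γ).map (linearSubstEquiv A) ↔
      F ∈ idealOfPoints Γ := by
    refine ⟨fun h => ?_, Ideal.mem_map_of_mem _⟩
    have := (Ideal.mem_map_of_equiv (linearSubstEquiv A).toRingEquiv _).1 h
    obtain ⟨x, hx, hxF⟩ := this
    rwa [← (linearSubstEquiv A).injective hxF]
  rw [hiff, mem_idealOfPoints_iff]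
  have hev : ∀ d x, eval x (homogeneousComponent d (linearSubstEquiv A F)) =
      eval (∑ i, x i • v i) (homogeneousComponent d F) := by
    intro d x
    change eval x (homogeneousComponent d (linearSubst A.1 F)) = _
    rw [homogeneousComponent_linearSubst, eval_linearSubst, hA]
    rfl
  have hsingle : ∀ i, ∑ j, (Pi.single i 1 : Fin (n + 1) → k) j • v j = v i := by
    intro i
    simp [Pi.single_apply]
  have hcons : ∑ j, (Fin.cons 0 1 : Fin (n + 1) → k) j • v j = w.rep := by
    rw [Fin.sum_univ_succ, ← h2]
    simp
  simp only [hev, hsingle, hcons]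
  have hP : ∀ i d, eval (v i.succ) (homogeneousComponent d F) = 0 ↔
      eval (P i).rep (homogeneousComponent d F) = 0 := by
    intro i d
    obtain ⟨c, hc, hvi⟩ := h1 i
    rw [hvi, (homogeneousComponent_isHomogeneous d F).eval_smul_eq, mul_eq_zero]
    exact or_iff_right (pow_ne_zero _ hc)
  simp only [Fin.forall_fin_succ, hP, h0, hmem]
  constructor
  · intro h d
    exact ⟨⟨h q (Or.inl rfl) d, fun i => h (P i) (Or.inr (Or.inr ⟨i, rfl⟩)) d⟩,
      h w (Or.inr (Or.inl rfl)) d⟩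
  · rintro h p (rfl | rfl | ⟨i, rfl⟩) d
    · exact (h d).1.1
    · exact (h d).2
    · exact (h d).1.2 i

theorem theorem4p4 {k : Type*} [Field k] [IsAlgClosed k] (n : ℕ) (hn : 2 ≤ n)
    (Γ : Finset (ℙ k (Fin (n + 1) → k))) (hcard : Γ.card = n + 2)
    (hΓ : InHyperplaneLinearPosition Γ)
    (m : ℕ) (f : Fin m → MvPolynomial (Fin (n + 1)) k)
    (hf : Ideal.span (Set.range f) = idealOfPoints Γ) :
    IsAluffiTorsionFree (idealOfPoints Γ)
      (idealOfPoints Γ ⊔ minorsIdeal n (jacobianMatrix f)) := by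
  refine isAluffiTorsionFree_of_le le_sup_left fun t ht => ?_
  have hjac : idealOfPoints Γ ⊔ minorsIdeal n (jacobianMatrix f) =
      jacobianIdeal n (idealOfPoints Γ) := by
    rw [← hf, sup_minorsIdeal_eq_jacobianIdeal]
  obtain ⟨e, he⟩ := hΓ.exists_isStandardIdeal_map hcard
  rw [hjac]
  refine Ideal.inf_pow_le_of_map_equiv e.toRingEquiv ?_
  have h := he.inf_jacobianIdeal_pow_le hn (t := t) (by omega)
  rwa [← map_jacobianIdeal] at h
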